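/- Let $0<a\le b<1$ and $\beta>b$, and let $H:\mathbb R\to[a,b]$ be such that for every compact $K\subset\mathbb R$ there is $c>0$ with $|H(t_1)-H(t_2)|\le c\,|t_1-t_2|^{\beta}$ for all $t_1,t_2\in K$. Write $\widehat f(\xi)=(2\pi)^{-1/2}\int_{\mathbb R}e^{-ix\xi}f(x)\,dx$. Let $dW$ be a real white noise on $\mathbb R$, defined on a probability space $\Omega$ (so that the Wiener integrals $\int f\,dW$, $f\in L^2(\mathbb R)$ real valued, form a centred Gaussian process with covariance $\langle f,g\rangle_{L^2}$, and $\int f\,dW$ is extended linearly to complex $f$), and let $d\widehat W$ be its Fourier transform, i.e. $\int \widehat f\,d\widehat W=\int f\,dW$ for all $f\in L^2(\mathbb R)$. Let $X=\{X(t)\}_{t\in\mathbb R}$ be multifractional Brownian motion with functional parameter $H$, i.e. the real process with almost surely continuous paths such that for every $t\in\mathbb R$, almost surely, $$X(t)=\int_{\mathbb R}\frac{e^{it\xi}-1}{|\xi|^{H(t)+1/2}}\,d\widehat W(\xi).$$ Let $\psi$ generate a Lemarié–Meyer wavelet basis: $\psi$ is a real-valued Schwartz function, $\widehat\psi$ is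 compactly supported and vanishes on a neighbourhood of $0$, and $\{2^{j/2}\psi(2^jx-k):(j,k)\in\mathbb Z^2\}$ is an orthonormal basis of $L^2(\mathbb R)$. Put $$\Psi(x,\theta)=\int_{\mathbb R}e^{ix\xi}\frac{\widehat\psi(\xi)}{|\xi|^{\theta+1/2}}\,d\xi,\qquad \varepsilon_{j,k}=\int_{\mathbb R}2^{-j/2}e^{i2^{-j}k\xi}\,\widehat\psi(-2^{-j}\xi)\,d\widehat W(\xi),$$ and $$Z(t)=\sum_{(j,k)\in\mathbb Z^2}2^{-jH(k/2^j)}\,\varepsilon_{j,k}\Big\{\Psi\big(2^jt-k,H(k/2^j)\big)-\Psi\big(-k,H(k/2^j)\big)\Big\},$$ the process obtained by putting $H(k/2^j)$ in place of the Hurst parameter in each term of the wavelet series of fractional Brownian motion. Assume that $$1-b>(1-a)(1-ab^{-1}).$$ Then, almost surely, the series defining $Z(t)$ converges absolutely for every $t\in\mathbb R$; and for every compact interval $\mathcal K\subset\mathbb R$ there are a deterministic exponent $d\in(b,1]$ and a nonnegative random variable $C_1$ with finite moments of every order such that the process $R=Z-X$ satisfies, almost surely, $$|R(t_1)-R(t_0)|\le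 C_1\,|t_1-t_0|^{d}\qquad\text{for all } t_0,t_1\in\mathcal K.$$ -/

import Mathlib

open MeasureTheory ProbabilityTheory
open scoped FourierTransform SchwartzMap NNReal

/-- The Fourier transform in its unitary normalisation,
`f̂(ξ) = (2π)^{-1/2} ∫ e^{-ixξ} f(x) dx`. -/
noncomputable def unitaryFourier (f : ℝ → ℂ) (ξ : ℝ) : ℂ :=
  ((√(2 * Real.pi))⁻¹ : ℝ) * ∫ x : ℝ, Complex.exp (-(Complex.I * (x * ξ))) * f x

/-! ### Lemarié–Meyer wavelets -/

/-- The function `x ↦ 2^{j/2} ψ(2^j x - k)`. -/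
noncomputable def waveletFun (ψ : 𝓢(ℝ, ℝ)) (j k : ℤ) (x : ℝ) : ℝ :=
  (2 : ℝ) ^ ((j : ℝ) / 2) * ψ ((2 : ℝ) ^ j * x - k)

lemma memLp_waveletFun (ψ : 𝓢(ℝ, ℝ)) (j k : ℤ) :
    MemLp (waveletFun ψ j k) 2 (volume : Measure ℝ) := by
  have h2 : ((2 : ℝ) ^ j) ≠ 0 := by positivity
  have hc : Continuous (waveletFun ψ j k) := by
    unfold waveletFun
    have := ψ.continuous
    fun_prop
  have h := (memLp_two_iff_integrable_sq (μ := (volume : Measure ℝ))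
    ψ.continuous.aestronglyMeasurable).1 (ψ.memLp 2 volume)
  have h' := ((h.comp_sub_right (k : ℝ)).comp_mul_left' h2).const_mul
    (((2 : ℝ) ^ ((j : ℝ) / 2)) ^ 2)
  refine (memLp_two_iff_integrable_sq hc.aestronglyMeasurable).2 (h'.congr ?_)
  filter_upwards with x
  simp only [waveletFun]
  ring

/-- The element of `L²(ℝ)` given by `x ↦ 2^{j/2} ψ(2^j x - k)`, for `p = (j, k)`. -/
noncomputable def waveletLp (ψ : 𝓢(ℝ, ℝ)) (p : ℤ × ℤ) : Lp ℝ 2 (volume : Measure ℝ) :=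
  (memLp_waveletFun ψ p.1 p.2).toLp

/-- The Fourier transform `ψ̂` of a real valued wavelet. -/
noncomputable def waveletHat (ψ : 𝓢(ℝ, ℝ)) : ℝ → ℂ := unitaryFourier (fun x => (ψ x : ℂ))

/-- `ψ` generates a Lemarié–Meyer wavelet basis of `L²(ℝ)`: it is a real valued Schwartz function
whose Fourier transform has compact support and vanishes on a neighbourhood of the origin, and the
functions `2^{j/2} ψ(2^j x - k)`, `(j, k) ∈ ℤ²`, form an orthonormal basis of `L²(ℝ)`. -/
structure IsLemarieMeyerWavelet (ψ : 𝓢(ℝ, ℝ)) : Prop where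
  hasCompactSupport_hat : HasCompactSupport (waveletHat ψ)
  hat_eq_zero_near_zero : ∃ r : ℝ, 0 < r ∧ ∀ ξ : ℝ, |ξ| < r → waveletHat ψ ξ = 0
  orthonormal : Orthonormal ℝ (waveletLp ψ)
  dense_span : (Submodule.span ℝ (Set.range (waveletLp ψ))).topologicalClosure = ⊤

/-- `Ψ(x, θ) = ∫ e^{ixξ} ψ̂(ξ) / |ξ|^{θ + 1/2} dξ`. -/
noncomputable def bigPsi (ψ : 𝓢(ℝ, ℝ)) (x θ : ℝ) : ℂ :=
  ∫ ξ : ℝ, Complex.exp (Complex.I * (x * ξ)) * waveletHat ψ ξ / ((|ξ| ^ (θ + 1 / 2) : ℝ) : ℂ)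

lemma conj_waveletHat (ψ : 𝓢(ℝ, ℝ)) (ξ : ℝ) :
    (starRingEnd ℂ) (waveletHat ψ ξ) = waveletHat ψ (-ξ) := by
  unfold waveletHat unitaryFourier
  rw [map_mul, Complex.conj_ofReal, ← integral_conj]
  congr 2
  funext x
  rw [map_mul, ← Complex.exp_conj]
  simp

/-- Since `ψ` is real valued, so is `Ψ`. -/
lemma bigPsi_im (ψ : 𝓢(ℝ, ℝ)) (x θ : ℝ) : (bigPsi ψ x θ).im = 0 := by
  rw [← Complex.conj_eq_iff_im]
  unfold bigPsi
  rw [← integral_conj, ← integral_neg_eq_self]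
  congr 1
  funext ξ
  rw [map_div₀, map_mul, ← Complex.exp_conj, conj_waveletHat, Complex.conj_ofReal]
  simp

/-! ### White noise and its Fourier transform -/

/-- `W` is a real white noise on `ℝ`: `W f` is the Wiener integral `∫ f dW` of `f ∈ L²(ℝ)`, that is,
`W` is a centred Gaussian process indexed by `L²(ℝ)` with `E[W f * W g] = ⟨f, g⟩`. -/
structure IsWhiteNoise {Ω : Type*} [MeasurableSpace Ω] (P : Measure Ω)
    (W : Lp ℝ 2 (volume : Measure ℝ) → Ω → ℝ) : Prop where
  isGaussianProcess : IsGaussianProcess W P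
  mean_zero : ∀ f, ∫ ω, W f ω ∂P = 0
  covariance : ∀ f g, ∫ ω, W f ω * W g ω ∂P = inner ℝ f g

/-- The Wiener integral `∫ f dW` of a complex valued `f ∈ L²(ℝ)`. -/
noncomputable def complexWienerIntegral {Ω : Type*} (W : Lp ℝ 2 (volume : Measure ℝ) → Ω → ℝ)
    (f : Lp ℂ 2 (volume : Measure ℝ)) (ω : Ω) : ℂ :=
  (W (Complex.reCLM.compLp f) ω : ℂ) + Complex.I * (W (Complex.imCLM.compLp f) ω : ℂ)

/-- `η ↦ (2π)^{1/2} g(2πη)`. If `g` is the unitary Fourier transform of `f`, this is the transform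
of `f` with kernel `e^{-2πixη}`. -/
noncomputable def rescaleFreq (g : ℝ → ℂ) (η : ℝ) : ℂ :=
  (√(2 * Real.pi) : ℝ) * g (2 * Real.pi * η)

/-- The two normalisations of the Fourier transform are related by `rescaleFreq`. -/
lemma rescaleFreq_unitaryFourier (f : ℝ → ℂ) : rescaleFreq (unitaryFourier f) = 𝓕 f := by
  funext η
  have h : ((√(2 * Real.pi) : ℝ) : ℂ) ≠ 0 := by
    rw [Complex.ofReal_ne_zero]; positivity
  unfold rescaleFreq unitaryFourier
  rw [Complex.ofReal_inv, ← mul_assoc, mul_inv_cancel₀ h, one_mul, Real.fourier_real_eq_integral_exp_smul]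
  congr 1
  funext x
  rw [smul_eq_mul]
  congr 2
  push_cast
  ring

open Classical in
/-- The stochastic integral `∫ g(ξ) dŴ(ξ)` of `g ∈ L²(ℝ)` with respect to the Fourier transform `dŴ`
of the white noise `dW`: it is `∫ f dW`, where `f ∈ L²(ℝ)` has unitary Fourier transform `g`. -/
noncomputable def fourierWienerIntegral {Ω : Type*} (W : Lp ℝ 2 (volume : Measure ℝ) → Ω → ℝ)
    (g : ℝ → ℂ) (ω : Ω) : ℂ :=
  if h : MemLp (rescaleFreq g) 2 (volume : Measure ℝ) then
    complexWienerIntegral W (𝓕⁻ (h.toLp : Lp ℂ 2 (volume : Measure ℝ))) ω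
  else 0

/-! ### Multifractional Brownian motion and the wavelet process -/

/-- The kernel `ξ ↦ (e^{itξ} - 1) / |ξ|^{θ + 1/2}`. -/
noncomputable def harmonizableKernel (t θ ξ : ℝ) : ℂ :=
  (Complex.exp (Complex.I * (t * ξ)) - 1) / ((|ξ| ^ (θ + 1 / 2) : ℝ) : ℂ)

/-- `X` is the multifractional Brownian motion with functional parameter `H` driven by `W`: the
process with continuous paths such that `X(t) = ∫ (e^{itξ} - 1) / |ξ|^{H(t) + 1/2} dŴ(ξ)` almost
surely, for every `t`. -/
structure IsMultifractionalBM {Ω : Type*} [MeasurableSpace Ω] (P : Measure Ω)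
    (W : Lp ℝ 2 (volume : Measure ℝ) → Ω → ℝ) (H : ℝ → ℝ) (X : ℝ → Ω → ℝ) : Prop where
  continuous_paths : ∀ᵐ ω ∂P, Continuous (fun t => X t ω)
  ae_eq : ∀ t : ℝ, ∀ᵐ ω ∂P,
    (X t ω : ℂ) = fourierWienerIntegral W (harmonizableKernel t (H t)) ω

/-- The function `ξ ↦ 2^{-j/2} e^{i 2^{-j} k ξ} ψ̂(-2^{-j} ξ)`. -/
noncomputable def waveletFreq (ψ : 𝓢(ℝ, ℝ)) (j k : ℤ) (ξ : ℝ) : ℂ :=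
  (((2 : ℝ) ^ (-(j : ℝ) / 2) : ℝ) : ℂ) *
    Complex.exp (Complex.I * ((((2 : ℝ) ^ (-j) * k * ξ : ℝ)) : ℂ)) *
      waveletHat ψ (-((2 : ℝ) ^ (-j) * ξ))

/-- The family `ε` consists of the wavelet coefficients of `dŴ`:
`ε j k = ∫ 2^{-j/2} e^{i 2^{-j} k ξ} ψ̂(-2^{-j} ξ) dŴ(ξ)` almost surely. -/
def IsWaveletCoefficients {Ω : Type*} [MeasurableSpace Ω] (P : Measure Ω)
    (W : Lp ℝ 2 (volume : Measure ℝ) → Ω → ℝ) (ψ : 𝓢(ℝ, ℝ)) (ε : ℤ → ℤ → Ω → ℝ) : Prop :=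
  ∀ j k : ℤ, ∀ᵐ ω ∂P, (ε j k ω : ℂ) = fourierWienerIntegral W (waveletFreq ψ j k) ω

/-- The term of index `p = (j, k)` of the series defining `Z(t)`,
`2^{-j H(k/2^j)} ε_{j,k} {Ψ(2^j t - k, H(k/2^j)) - Ψ(-k, H(k/2^j))}`. -/
noncomputable def waveletProcessTerm {Ω : Type*} (ψ : 𝓢(ℝ, ℝ)) (H : ℝ → ℝ) (ε : ℤ → ℤ → Ω → ℝ)
    (t : ℝ) (ω : Ω) (p : ℤ × ℤ) : ℝ :=
  (2 : ℝ) ^ (-(p.1 : ℝ) * H ((p.2 : ℝ) / (2 : ℝ) ^ p.1)) * ε p.1 p.2 ω *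
    ((bigPsi ψ ((2 : ℝ) ^ p.1 * t - p.2) (H ((p.2 : ℝ) / (2 : ℝ) ^ p.1))).re -
      (bigPsi ψ (-(p.2 : ℝ)) (H ((p.2 : ℝ) / (2 : ℝ) ^ p.1))).re)

/-- The wavelet process `Z`. -/
noncomputable def waveletProcess {Ω : Type*} (ψ : 𝓢(ℝ, ℝ)) (H : ℝ → ℝ) (ε : ℤ → ℤ → Ω → ℝ)
    (t : ℝ) (ω : Ω) : ℝ :=
  ∑' p : ℤ × ℤ, waveletProcessTerm ψ H ε t ω p

/-!
The proof is pathwise. The reflected wavelets `x ↦ 2^{j/2} ψ(-2^j x - k)` form an orthonormal basis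
of `L²(ℝ)`; the coefficients `ε_{j,k}` are the values of the white noise on it, hence standard
Gaussian, and `|ε_{j,k}| ≤ M (1 + |j|) (1 + |k|)^δ` with `M` having moments of every order, for any
`δ > 0` (`exists_coeff_bound`). By Plancherel's theorem the kernel of fractional Brownian motion
with Hurst parameter `θ` has the coefficients
`T_{j,k}(t, θ) = 2^{-jθ} (Ψ(2^j t - k, θ) - Ψ(-k, θ))`, so that, for fixed `t`, almost surely
`X(t) = ∑ ε_{j,k} T_{j,k}(t, H(t))` (`IsMultifractionalBM.exists_ae_eq`,
`IsWhiteNoise.ae_eq_tsum`). Both sides being continuous in `t`, the identity holds for all `t`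
simultaneously, while `Z(t) = ∑ ε_{j,k} T_{j,k}(t, H(k/2^j))`.

As `ψ̂` is smooth, compactly supported and zero near the origin, repeated integration by parts bounds
`Ψ(x, θ)`, its increments in `x` and their derivative in `θ` by `(1 + |x|)^{-4}`, uniformly in `θ`
(`IsAnnular.exists_norm_annularIncr_le`).

Put `R = Z - X` and `h = |t₁ - t₀|`. Then `R(t₁) - R(t₀)` is the sum over `(j, k)` of
`ε_{j,k} ((T(t₁, H(k/2^j)) - T(t₀, H(k/2^j))) - (T(t₁, H(t₀)) - T(t₀, H(t₀))))` minus that of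
`ε_{j,k} (T(t₁, H(t₁)) - T(t₁, H(t₀)))`. The second sum is `O(|H(t₁) - H(t₀)|)`, since the series is
Lipschitz in the exponent. In the first one, the factor `|H(k/2^j) - H(t₀)|` is at most
`c |k/2^j - t₀|^d` with `d = min(β, 1)`; the decay in `2^j t - k` turns this into `2^{-jd}`, and
`2^{-jd} min(1, 2^j h) ≤ h^d` leaves the full factor `2^{-ja}` for the summation over the scales
`j ≥ 0`; for `j < 0` it is `2^{j(1-b)}` (`abs_sub_mul_scaleBound_mul_min_le`). Hence the exponent
`d = min(β, 1) > b`.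
-/

/-! ### Oscillatory integrals with amplitude supported in an annulus -/

/-- Smooth compactly supported functions on the line that vanish near the origin. -/
structure IsAnnular (f : ℝ → ℂ) : Prop where
  contDiff : ContDiff ℝ ((⊤ : ℕ∞) : WithTop ℕ∞) f
  hasCompactSupport : HasCompactSupport f
  eq_zero_near_zero : ∃ r : ℝ, 0 < r ∧ ∀ ξ : ℝ, |ξ| < r → f ξ = 0

namespace IsAnnular

variable {f : ℝ → ℂ}

lemma map_zero (hf : IsAnnular f) : f 0 = 0 := by
  obtain ⟨r, hr, h⟩ := hf.eq_zero_near_zero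
  exact h 0 (by simpa using hr)

lemma eventually_eq_zero (hf : IsAnnular f) : f =ᶠ[nhds 0] fun _ => 0 := by
  obtain ⟨r, hr, h⟩ := hf.eq_zero_near_zero
  filter_upwards [Metric.ball_mem_nhds (0 : ℝ) hr] with ξ hξ
  exact h ξ (by simpa using hξ)

lemma deriv (hf : IsAnnular f) : IsAnnular (deriv f) := by
  refine ⟨?_, hf.hasCompactSupport.deriv, ?_⟩
  · exact (contDiff_infty_iff_deriv.1 hf.contDiff).2
  · obtain ⟨r, hr, h⟩ := hf.eq_zero_near_zero
    refine ⟨r, hr, fun ξ hξ => ?_⟩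
    have : f =ᶠ[nhds ξ] fun _ => (0 : ℂ) := by
      filter_upwards [(isOpen_lt continuous_abs continuous_const).mem_nhds hξ] with x hx
      exact h x hx
    rw [this.deriv_eq]
    simp

/-- Multipliers of annular functions may be singular at the origin. -/
lemma mul (hf : IsAnnular f) {g : ℝ → ℂ}
    (hg : ∀ ξ : ℝ, ξ ≠ 0 → ContDiffAt ℝ ((⊤ : ℕ∞) : WithTop ℕ∞) g ξ) :
    IsAnnular (fun ξ => f ξ * g ξ) := by
  refine ⟨?_, hf.hasCompactSupport.mul_right, ?_⟩
  · rw [contDiff_iff_contDiffAt]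
    intro ξ
    by_cases h0 : ξ = 0
    · subst h0
      refine (contDiffAt_const (c := (0 : ℂ))).congr_of_eventuallyEq ?_
      filter_upwards [hf.eventually_eq_zero] with x hx
      simp [hx]
    · exact hf.contDiff.contDiffAt.mul (hg ξ h0)
  · obtain ⟨r, hr, h⟩ := hf.eq_zero_near_zero
    exact ⟨r, hr, fun ξ hξ => by simp [h ξ hξ]⟩

lemma integrable (hf : IsAnnular f) : Integrable f :=
  hf.contDiff.continuous.integrable_of_hasCompactSupport hf.hasCompactSupport

end IsAnnular

lemma contDiffAt_ofReal {g : ℝ → ℝ} {ξ : ℝ} {n : WithTop ℕ∞} (h : ContDiffAt ℝ n g ξ) :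
    ContDiffAt ℝ n (fun x => (g x : ℂ)) ξ :=
  (Complex.ofRealCLM.contDiff.contDiffAt).comp ξ h

lemma contDiffAt_abs_rpow (p : ℝ) {ξ : ℝ} (h : ξ ≠ 0) :
    ContDiffAt ℝ ((⊤ : ℕ∞) : WithTop ℕ∞) (fun x : ℝ => ((|x| ^ p : ℝ) : ℂ)) ξ := by
  refine contDiffAt_ofReal ?_
  exact (Real.contDiffAt_rpow_const_of_ne (p := p) (abs_ne_zero.2 h)).comp ξ (contDiffAt_abs h)

lemma contDiffAt_log_abs {ξ : ℝ} (h : ξ ≠ 0) :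
    ContDiffAt ℝ ((⊤ : ℕ∞) : WithTop ℕ∞) (fun x : ℝ => ((Real.log |x| : ℝ) : ℂ)) ξ := by
  refine contDiffAt_ofReal ?_
  exact (contDiffAt_abs h).log (abs_ne_zero.2 h)

lemma contDiffAt_inv_ofReal {ξ : ℝ} (h : ξ ≠ 0) :
    ContDiffAt ℝ ((⊤ : ℕ∞) : WithTop ℕ∞) (fun x : ℝ => ((x : ℂ))⁻¹) ξ :=
  (contDiffAt_ofReal contDiffAt_id).inv (by simpa using h)

lemma contDiff_cexp_I_mul (x : ℝ) :
    ContDiff ℝ ((⊤ : ℕ∞) : WithTop ℕ∞) (fun ξ : ℝ => Complex.exp (Complex.I * (x * ξ))) :=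
  (contDiff_const.mul (contDiff_const.mul Complex.ofRealCLM.contDiff)).cexp

/-- The integral `∫ e^{ixξ} f(ξ) |ξ|^{-s-1/2} dξ`. For `f = ψ̂` this is `Ψ(x, s)`. -/
noncomputable def annularInt (f : ℝ → ℂ) (x s : ℝ) : ℂ :=
  ∫ ξ : ℝ, Complex.exp (Complex.I * (x * ξ)) * f ξ / ((|ξ| ^ (s + 1 / 2) : ℝ) : ℂ)

lemma IsAnnular.integrand {f : ℝ → ℂ} (hf : IsAnnular f) (x s : ℝ) :
    IsAnnular fun ξ : ℝ =>
      Complex.exp (Complex.I * (x * ξ)) * f ξ / ((|ξ| ^ (s + 1 / 2) : ℝ) : ℂ) := by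
  have := hf.mul (g := fun ξ => Complex.exp (Complex.I * (x * ξ)) *
    (((|ξ| ^ (s + 1 / 2) : ℝ) : ℂ))⁻¹) (fun ξ h => by
      refine (contDiff_cexp_I_mul x).contDiffAt.mul ((contDiffAt_abs_rpow _ h).inv ?_)
      rw [Complex.ofReal_ne_zero]
      exact (Real.rpow_pos_of_pos (abs_pos.2 h) _).ne')
  convert this using 2 with ξ
  rw [div_eq_mul_inv]; ring

lemma norm_cexp_I_mul (x ξ : ℝ) : ‖Complex.exp (Complex.I * (x * ξ))‖ = 1 := by
  have : Complex.I * (x * ξ) = ((x * ξ : ℝ) : ℂ) * Complex.I := by push_cast; ring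
  rw [this, Complex.norm_exp_ofReal_mul_I]

/-- An amplitude dominating `f(ξ) |ξ|^{-s-1/2}` for all `s ∈ [-1, 2]`. -/
noncomputable def annularBound (f : ℝ → ℂ) (ξ : ℝ) : ℝ :=
  ‖f ξ * (((|ξ| ^ (1 / 2 : ℝ) : ℝ) : ℂ) + ((|ξ| ^ (-(5 / 2) : ℝ) : ℝ) : ℂ))‖

lemma IsAnnular.integrable_annularBound {f : ℝ → ℂ} (hf : IsAnnular f) :
    Integrable (annularBound f) :=
  (hf.mul fun _ h => (contDiffAt_abs_rpow _ h).add (contDiffAt_abs_rpow _ h)).integrable.norm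

lemma IsAnnular.norm_integrand_le {f : ℝ → ℂ} (hf : IsAnnular f) (x : ℝ) {s : ℝ}
    (hs : s ∈ Set.Icc (-1 : ℝ) 2) (ξ : ℝ) :
    ‖Complex.exp (Complex.I * (x * ξ)) * f ξ / ((|ξ| ^ (s + 1 / 2) : ℝ) : ℂ)‖
      ≤ annularBound f ξ := by
  by_cases h0 : ξ = 0
  · subst h0
    simp [hf.map_zero, annularBound]
  have hpos : 0 < |ξ| := abs_pos.2 h0
  unfold annularBound
  rw [div_eq_mul_inv, norm_mul, norm_mul, norm_mul, norm_cexp_I_mul, one_mul, ← Complex.ofReal_inv,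
    ← Real.rpow_neg hpos.le, ← Complex.ofReal_add, Complex.norm_real, Complex.norm_real]
  gcongr ‖f ξ‖ * ?_
  have h1 := Real.rpow_nonneg hpos.le (1 / 2 : ℝ)
  have h2 := Real.rpow_nonneg hpos.le (-(5 / 2) : ℝ)
  rw [Real.norm_of_nonneg (Real.rpow_nonneg hpos.le _), Real.norm_of_nonneg (by positivity)]
  rcases le_total 1 |ξ| with h | h
  · have := Real.rpow_le_rpow_of_exponent_le h (show -(s + 1 / 2) ≤ 1 / 2 by linarith [hs.1])
    linarith
  · have := Real.rpow_le_rpow_of_exponent_ge hpos h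
      (show (-(5 / 2) : ℝ) ≤ -(s + 1 / 2) by linarith [hs.2])
    linarith

lemma IsAnnular.exists_norm_annularInt_le {f : ℝ → ℂ} (hf : IsAnnular f) :
    ∃ C : ℝ, 0 ≤ C ∧ ∀ x : ℝ, ∀ s ∈ Set.Icc (-1 : ℝ) 2, ‖annularInt f x s‖ ≤ C := by
  refine ⟨∫ ξ, annularBound f ξ, integral_nonneg fun ξ => norm_nonneg _, fun x s hs => ?_⟩
  exact norm_integral_le_of_norm_le hf.integrable_annularBound
    (Filter.Eventually.of_forall (hf.norm_integrand_le x hs))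

lemma hasDerivAt_abs_rpow_of_ne (p : ℝ) {ξ : ℝ} (h : ξ ≠ 0) :
    HasDerivAt (fun x : ℝ => |x| ^ p) (p * |ξ| ^ p / ξ) ξ := by
  have hpos : 0 < |ξ| := abs_pos.2 h
  have := (Real.hasDerivAt_rpow_const (p := p) (Or.inl hpos.ne')).comp ξ (hasDerivAt_abs h)
  refine this.congr_deriv ?_
  rw [Real.rpow_sub_one hpos.ne']
  rcases lt_or_gt_of_ne h with h' | h'
  · rw [abs_of_neg h', sign_neg h']
    simp only [SignType.coe_neg_one]
    have : ξ ≠ 0 := h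
    field_simp
  · rw [abs_of_pos h', sign_pos h']
    simp only [SignType.coe_one]
    field_simp

/-- Integration by parts: multiplication by `x` acts on annular amplitudes. -/
lemma IsAnnular.mul_annularInt {f : ℝ → ℂ} (hf : IsAnnular f) (x s : ℝ) :
    Complex.I * x * annularInt f x s =
      ((s + 1 / 2 : ℝ) : ℂ) * annularInt (fun ξ => f ξ * (ξ : ℂ)⁻¹) x s
        - annularInt (_root_.deriv f) x s := by
  have hd := hf.deriv
  have hi := hf.mul (g := fun ξ : ℝ => (ξ : ℂ)⁻¹) fun ξ h => contDiffAt_inv_ofReal h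
  have h1 := (hf.integrand x s).integrable
  have h2 := (hd.integrand x s).integrable
  have h3 := (hi.integrand x s).integrable
  have key := integral_eq_zero_of_hasDerivAt_of_integrable
    (f := fun ξ : ℝ => Complex.exp (Complex.I * (x * ξ)) * f ξ / ((|ξ| ^ (s + 1 / 2) : ℝ) : ℂ))
    (f' := fun ξ : ℝ => Complex.I * x * (Complex.exp (Complex.I * (x * ξ)) * f ξ /
        ((|ξ| ^ (s + 1 / 2) : ℝ) : ℂ)) + Complex.exp (Complex.I * (x * ξ)) * _root_.deriv f ξ /
        ((|ξ| ^ (s + 1 / 2) : ℝ) : ℂ) - ((s + 1 / 2 : ℝ) : ℂ) *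
        (Complex.exp (Complex.I * (x * ξ)) * (f ξ * (ξ : ℂ)⁻¹) / ((|ξ| ^ (s + 1 / 2) : ℝ) : ℂ)))
    (fun ξ => ?_) (((h1.const_mul _).add h2).sub (h3.const_mul _)) h1
  · rw [integral_sub, integral_add, integral_const_mul, integral_const_mul] at key
    · unfold annularInt
      linear_combination key
    · exact h1.const_mul _
    · exact h2
    · exact (h1.const_mul _).add h2
    · exact h3.const_mul _
  by_cases h0 : ξ = 0
  · subst h0
    rw [hf.map_zero, hd.map_zero]
    refine (hasDerivAt_const (0 : ℝ) (0 : ℂ)).congr_of_eventuallyEq ?_ |>.congr_deriv (by simp)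
    filter_upwards [hf.eventually_eq_zero] with y hy
    simp [hy]
  · have hpos : 0 < |ξ| := abs_pos.2 h0
    have hne : ((|ξ| ^ (s + 1 / 2) : ℝ) : ℂ) ≠ 0 := by
      rw [Complex.ofReal_ne_zero]
      exact (Real.rpow_pos_of_pos hpos _).ne'
    have e1 : HasDerivAt (fun ξ : ℝ => Complex.exp (Complex.I * (x * ξ)))
        (Complex.exp (Complex.I * (x * ξ)) * (Complex.I * (x * 1))) ξ :=
      (((hasDerivAt_id ξ).ofReal_comp.const_mul (x : ℂ)).const_mul Complex.I).cexp
    have e2 : HasDerivAt f (_root_.deriv f ξ) ξ :=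
      (hf.contDiff.differentiable (by simp)).differentiableAt.hasDerivAt
    have e3 := (hasDerivAt_abs_rpow_of_ne (s + 1 / 2) h0).ofReal_comp
    refine ((e1.mul e2).div e3 hne).congr_deriv ?_
    have h0' : (ξ : ℂ) ≠ 0 := by simpa using h0
    push_cast at hne ⊢
    simp only [Pi.mul_apply]
    field_simp

/-- Rapid decay in `x`, uniformly in `s`. -/
lemma IsAnnular.exists_pow_mul_norm_annularInt_le (n : ℕ) :
    ∀ {f : ℝ → ℂ}, IsAnnular f → ∃ C : ℝ, 0 ≤ C ∧ ∀ x : ℝ, ∀ s ∈ Set.Icc (-1 : ℝ) 2,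
      |x| ^ n * ‖annularInt f x s‖ ≤ C := by
  induction n with
  | zero =>
    intro f hf
    simpa using hf.exists_norm_annularInt_le
  | succ n ih =>
    intro f hf
    obtain ⟨C1, h1, H1⟩ := ih (hf.mul (g := fun ξ : ℝ => (ξ : ℂ)⁻¹) fun ξ h =>
      contDiffAt_inv_ofReal h)
    obtain ⟨C2, h2, H2⟩ := ih hf.deriv
    refine ⟨5 / 2 * C1 + C2, by positivity, fun x s hs => ?_⟩
    have e : |x| * ‖annularInt f x s‖ = ‖Complex.I * x * annularInt f x s‖ := by
      simp
    have hs' : ‖((s + 1 / 2 : ℝ) : ℂ)‖ ≤ 5 / 2 := by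
      rw [Complex.norm_real, Real.norm_eq_abs, abs_le]
      constructor <;> linarith [hs.1, hs.2]
    have e2 : ‖Complex.I * x * annularInt f x s‖ ≤
        5 / 2 * ‖annularInt (fun ξ => f ξ * (ξ : ℂ)⁻¹) x s‖ + ‖annularInt (_root_.deriv f) x s‖ := by
      rw [hf.mul_annularInt]
      refine (norm_sub_le _ _).trans ?_
      rw [norm_mul]
      gcongr
    calc |x| ^ (n + 1) * ‖annularInt f x s‖ = |x| ^ n * (|x| * ‖annularInt f x s‖) := by ring
      _ ≤ |x| ^ n * (5 / 2 * ‖annularInt (fun ξ => f ξ * (ξ : ℂ)⁻¹) x s‖ +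
            ‖annularInt (_root_.deriv f) x s‖) := by rw [e]; gcongr
      _ = 5 / 2 * (|x| ^ n * ‖annularInt (fun ξ => f ξ * (ξ : ℂ)⁻¹) x s‖) +
            |x| ^ n * ‖annularInt (_root_.deriv f) x s‖ := by ring
      _ ≤ _ := by
        have a1 := H1 x s hs
        have a2 := H2 x s hs
        linarith

lemma IsAnnular.exists_norm_annularInt_le_div {f : ℝ → ℂ} (hf : IsAnnular f) :
    ∃ C : ℝ, 0 ≤ C ∧ ∀ x : ℝ, ∀ s ∈ Set.Icc (-1 : ℝ) 2,
      ‖annularInt f x s‖ ≤ C * ((1 + |x|) ^ 4)⁻¹ := by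
  obtain ⟨C0, h0, H0⟩ := hf.exists_pow_mul_norm_annularInt_le 0
  obtain ⟨C4, h4, H4⟩ := hf.exists_pow_mul_norm_annularInt_le 4
  refine ⟨8 * (C0 + C4), by positivity, fun x s hs => ?_⟩
  rw [← div_eq_mul_inv, le_div_iff₀ (by positivity)]
  have hx : (1 + |x|) ^ 4 ≤ 8 * (1 + |x| ^ 4) := by
    nlinarith [sq_nonneg (|x| - 1), sq_nonneg (|x| ^ 2 - 1), sq_nonneg (|x| ^ 2 - |x|),
      abs_nonneg x]
  have a0 := H0 x s hs
  have a4 := H4 x s hs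
  calc ‖annularInt f x s‖ * (1 + |x|) ^ 4 ≤ ‖annularInt f x s‖ * (8 * (1 + |x| ^ 4)) := by gcongr
    _ = 8 * (|x| ^ 0 * ‖annularInt f x s‖ + |x| ^ 4 * ‖annularInt f x s‖) := by ring
    _ ≤ _ := by linarith

lemma IsAnnular.hasDerivAt_annularInt_left {f : ℝ → ℂ} (hf : IsAnnular f) (x : ℝ) {s : ℝ}
    (hs : s ∈ Set.Icc (-1 : ℝ) 2) :
    HasDerivAt (fun x => annularInt f x s)
      (annularInt (fun ξ => f ξ * (Complex.I * ξ)) x s) x := by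
  have hg := hf.mul (g := fun ξ : ℝ => Complex.I * ξ) fun ξ _ =>
    contDiffAt_const.mul (contDiffAt_ofReal contDiffAt_id)
  refine (hasDerivAt_integral_of_dominated_loc_of_deriv_le (s := Set.univ) Filter.univ_mem
    (Filter.Eventually.of_forall fun y => (hf.integrand y s).integrable.aestronglyMeasurable)
    (hf.integrand x s).integrable (hg.integrand x s).integrable.aestronglyMeasurable
    (Filter.Eventually.of_forall fun ξ y _ => hg.norm_integrand_le y hs ξ)
    hg.integrable_annularBound
    (Filter.Eventually.of_forall fun ξ y _ => ?_)).2
  have e1 : HasDerivAt (fun y : ℝ => Complex.exp (Complex.I * (y * ξ)))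
      (Complex.exp (Complex.I * (y * ξ)) * (Complex.I * (1 * ξ))) y :=
    (((hasDerivAt_id y).ofReal_comp.mul_const (ξ : ℂ)).const_mul Complex.I).cexp
  refine ((e1.mul_const (f ξ)).div_const _).congr_deriv ?_
  ring

/-- Differentiation in the exponent multiplies the amplitude by `-log |ξ|`. -/
lemma IsAnnular.hasDerivAt_annularInt_right {f : ℝ → ℂ} (hf : IsAnnular f) (x : ℝ) {s : ℝ}
    (hs : s ∈ Set.Icc (0 : ℝ) 1) :
    HasDerivAt (fun s => annularInt f x s)
      (-annularInt (fun ξ => f ξ * ((Real.log |ξ| : ℝ) : ℂ)) x s) s := by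
  have hg := hf.mul (g := fun ξ : ℝ => ((Real.log |ξ| : ℝ) : ℂ)) fun ξ h => contDiffAt_log_abs h
  have hmem : Set.Icc (-1 : ℝ) 2 ∈ nhds s :=
    Icc_mem_nhds (by linarith [hs.1]) (by linarith [hs.2])
  unfold annularInt
  rw [← integral_neg]
  refine (hasDerivAt_integral_of_dominated_loc_of_deriv_le (s := Set.Icc (-1 : ℝ) 2)
    (F' := fun y ξ => -(Complex.exp (Complex.I * (x * ξ)) * (f ξ * ((Real.log |ξ| : ℝ) : ℂ)) /
      ((|ξ| ^ (y + 1 / 2) : ℝ) : ℂ))) hmem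
    (Filter.Eventually.of_forall fun y => (hf.integrand x y).integrable.aestronglyMeasurable)
    (hf.integrand x s).integrable (hg.integrand x s).integrable.neg.aestronglyMeasurable
    (Filter.Eventually.of_forall fun ξ y hy => ?_)
    hg.integrable_annularBound
    (Filter.Eventually.of_forall fun ξ y _ => ?_)).2
  · rw [norm_neg]
    exact hg.norm_integrand_le x hy ξ
  · by_cases h0 : ξ = 0
    · subst h0
      simp [hf.map_zero, hasDerivAt_const]
    have hpos : 0 < |ξ| := abs_pos.2 h0
    have hne : ((|ξ| ^ (y + 1 / 2) : ℝ) : ℂ) ≠ 0 := by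
      rw [Complex.ofReal_ne_zero]
      exact (Real.rpow_pos_of_pos hpos _).ne'
    have e1 : HasDerivAt (fun y : ℝ => |ξ| ^ (y + 1 / 2))
        (Real.log |ξ| * 1 * |ξ| ^ (y + 1 / 2)) y :=
      ((hasDerivAt_id y).add_const (1 / 2 : ℝ)).const_rpow hpos
    refine ((e1.ofReal_comp.inv hne).const_mul (Complex.exp (Complex.I * (x * ξ)) * f ξ)
      |>.congr_deriv ?_)
    push_cast at hne ⊢
    field_simp

/-- The increments in `x`, with the decay that makes sums over translates converge. -/
lemma IsAnnular.exists_norm_annularInt_sub_le {f : ℝ → ℂ} (hf : IsAnnular f) :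
    ∃ C : ℝ, 0 ≤ C ∧ ∀ x y : ℝ, ∀ s ∈ Set.Icc (-1 : ℝ) 2,
      ‖annularInt f x s - annularInt f y s‖ ≤
        C * min 1 |x - y| * (((1 + |x|) ^ 4)⁻¹ + ((1 + |y|) ^ 4)⁻¹) := by
  have hg := hf.mul (g := fun ξ : ℝ => Complex.I * ξ) fun ξ _ =>
    contDiffAt_const.mul (contDiffAt_ofReal contDiffAt_id)
  obtain ⟨C0, h0, H0⟩ := hf.exists_norm_annularInt_le_div
  obtain ⟨C1, h1, H1⟩ := hg.exists_norm_annularInt_le_div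
  refine ⟨C0 + 16 * C1, by positivity, fun x y s hs => ?_⟩
  set D := ((1 + |x|) ^ 4)⁻¹ + ((1 + |y|) ^ 4)⁻¹ with hD
  have hDpos : 0 ≤ D := by positivity
  rcases le_total 1 |x - y| with h | h
  · rw [min_eq_left h]
    have := norm_sub_le (annularInt f x s) (annularInt f y s)
    have a1 := H0 x s hs
    have a2 := H0 y s hs
    have : ‖annularInt f x s - annularInt f y s‖ ≤ C0 * D := by rw [hD, mul_add]; linarith
    have : 0 ≤ 16 * C1 * D := by positivity
    linarith
  · rw [min_eq_right h]
    have hb : ∀ z ∈ Set.uIcc y x,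
        ‖annularInt (fun ξ => f ξ * (Complex.I * ξ)) z s‖ ≤ 16 * C1 * ((1 + |x|) ^ 4)⁻¹ := by
      intro z hz
      refine (H1 z s hs).trans ?_
      -- on a segment of length at most one `1 + |z|` is comparable to `1 + |x|`
      have hzx : |x - z| ≤ 1 := by
        have := Set.abs_sub_right_of_mem_uIcc hz
        linarith
      have : |x| ≤ |z| + 1 := by
        have := abs_sub_abs_le_abs_sub x z
        linarith
      have h2 : (1 + |x|) / 2 ≤ 1 + |z| := by linarith [abs_nonneg z]
      have h3 : ((1 + |x|) / 2) ^ 4 ≤ (1 + |z|) ^ 4 := by gcongr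
      have h4 : ((1 + |z|) ^ 4)⁻¹ ≤ (((1 + |x|) / 2) ^ 4)⁻¹ := by
        gcongr
      have h5 : (((1 + |x|) / 2) ^ 4)⁻¹ = 16 * ((1 + |x|) ^ 4)⁻¹ := by
        field_simp; norm_num
      rw [h5] at h4
      nlinarith
    have := (convex_uIcc y x).norm_image_sub_le_of_norm_hasDerivWithin_le
      (fun z _ => (hf.hasDerivAt_annularInt_left z hs).hasDerivWithinAt) hb
      Set.left_mem_uIcc Set.right_mem_uIcc
    rw [Real.norm_eq_abs] at this
    refine this.trans ?_
    have e1 : ((1 + |x|) ^ 4)⁻¹ ≤ D := by rw [hD]; linarith [show 0 ≤ ((1 + |y|) ^ 4)⁻¹ by positivity]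
    calc 16 * C1 * ((1 + |x|) ^ 4)⁻¹ * |x - y| ≤ 16 * C1 * D * |x - y| := by gcongr
      _ ≤ (C0 + 16 * C1) * |x - y| * D := by
        have : 0 ≤ C0 * |x - y| * D := by positivity
        linarith

/-- The function `2^{-js} (I(x, s) - I(y, s))`, where `I = annularInt f`. -/
noncomputable def annularIncr (f : ℝ → ℂ) (j : ℤ) (x y s : ℝ) : ℂ :=
  (((2 : ℝ) ^ (-(j : ℝ) * s) : ℝ) : ℂ) * (annularInt f x s - annularInt f y s)

/-- Increments in `x` of `2^{-js} I(x, s)` and their Lipschitz dependence on the exponent `s`. -/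
lemma IsAnnular.exists_norm_annularIncr_le {f : ℝ → ℂ} (hf : IsAnnular f) :
    ∃ C : ℝ, 0 ≤ C ∧ ∀ (a b A : ℝ) (j : ℤ), 0 ≤ a → b ≤ 1 →
      (∀ s ∈ Set.Icc a b, (2 : ℝ) ^ (-(j : ℝ) * s) ≤ A) → ∀ x y : ℝ,
      (∀ s ∈ Set.Icc a b, ‖annularIncr f j x y s‖ ≤
        C * A * min 1 |x - y| * (((1 + |x|) ^ 4)⁻¹ + ((1 + |y|) ^ 4)⁻¹)) ∧
      (∀ s ∈ Set.Icc a b, ∀ s' ∈ Set.Icc a b,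
        ‖annularIncr f j x y s - annularIncr f j x y s'‖ ≤
          C * A * (1 + |(j : ℝ)|) * |s - s'| * min 1 |x - y| *
            (((1 + |x|) ^ 4)⁻¹ + ((1 + |y|) ^ 4)⁻¹)) := by
  have hg := hf.mul (g := fun ξ : ℝ => ((Real.log |ξ| : ℝ) : ℂ)) fun ξ h => contDiffAt_log_abs h
  obtain ⟨C0, h0, H0⟩ := hf.exists_norm_annularInt_sub_le
  obtain ⟨C1, h1, H1⟩ := hg.exists_norm_annularInt_sub_le
  refine ⟨C0 + C1, by positivity, fun a b A j ha hb hA x y => ?_⟩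
  set D := ((1 + |x|) ^ 4)⁻¹ + ((1 + |y|) ^ 4)⁻¹ with hD
  have hDpos : 0 ≤ D := by positivity
  set m := min 1 |x - y| with hm
  have hmpos : 0 ≤ m := le_min zero_le_one (abs_nonneg _)
  have hsub : ∀ s ∈ Set.Icc a b, s ∈ Set.Icc (-1 : ℝ) 2 := fun s hs =>
    ⟨by linarith [hs.1], by linarith [hs.2]⟩
  have hnorm : ∀ s, ‖(((2 : ℝ) ^ (-(j : ℝ) * s) : ℝ) : ℂ)‖ = (2 : ℝ) ^ (-(j : ℝ) * s) := fun s => by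
    rw [Complex.norm_real, Real.norm_of_nonneg (by positivity)]
  constructor
  · intro s hs
    have hA0 : 0 ≤ A := le_trans (by positivity) (hA s hs)
    unfold annularIncr
    rw [norm_mul, hnorm]
    calc _ ≤ A * (C0 * m * D) := mul_le_mul (hA s hs) (H0 x y s (hsub s hs)) (norm_nonneg _) hA0
      _ ≤ _ := by
        have : 0 ≤ C1 * A * m * D := by positivity
        linarith
  · intro s hs s' hs'
    have hA0 : 0 ≤ A := le_trans (by positivity) (hA s hs)
    have hder : ∀ u ∈ Set.Icc a b, HasDerivWithinAt (fun s => annularIncr f j x y s)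
        (((Real.log 2 * (-(j : ℝ)) * (2 : ℝ) ^ (-(j : ℝ) * u) : ℝ) : ℂ) *
          (annularInt f x u - annularInt f y u) + (((2 : ℝ) ^ (-(j : ℝ) * u) : ℝ) : ℂ) *
          (-annularInt (fun ξ => f ξ * ((Real.log |ξ| : ℝ) : ℂ)) x u -
            -annularInt (fun ξ => f ξ * ((Real.log |ξ| : ℝ) : ℂ)) y u)) (Set.Icc a b) u := by
      intro u hu
      have hu' : u ∈ Set.Icc (0 : ℝ) 1 := ⟨ha.trans hu.1, hu.2.trans hb⟩
      have e1 : HasDerivAt (fun s : ℝ => (2 : ℝ) ^ (-(j : ℝ) * s))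
          (Real.log 2 * (-(j : ℝ)) * (2 : ℝ) ^ (-(j : ℝ) * u)) u := by
        have := ((hasDerivAt_id u).const_mul (-(j : ℝ))).const_rpow (show (0 : ℝ) < 2 by norm_num)
        simpa using this
      exact (e1.ofReal_comp.mul ((hf.hasDerivAt_annularInt_right x hu').sub
        (hf.hasDerivAt_annularInt_right y hu'))).hasDerivWithinAt
    have := (convex_Icc a b).norm_image_sub_le_of_norm_hasDerivWithin_le hder
      (C := (C0 + C1) * A * (1 + |(j : ℝ)|) * m * D) (fun u hu => ?_) hs' hs
    · rw [Real.norm_eq_abs] at this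
      calc _ ≤ _ := this
        _ = _ := by ring
    · have b1 := H0 x y u (hsub u hu)
      have b2 := H1 x y u (hsub u hu)
      have b3 := hA u hu
      refine (norm_add_le _ _).trans ?_
      rw [norm_mul, norm_mul, hnorm, neg_sub_neg, norm_sub_rev (annularInt _ y u), Complex.norm_real,
        norm_mul, norm_mul, Real.norm_of_nonneg (show 0 ≤ (2 : ℝ) ^ (-(j : ℝ) * u) by positivity),
        norm_neg, Real.norm_eq_abs, Real.norm_eq_abs, abs_of_nonneg (Real.log_nonneg one_le_two)]
      have hlog : Real.log 2 ≤ 1 := by linarith [Real.log_two_lt_d9]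
      have hlog0 : 0 ≤ Real.log 2 := Real.log_nonneg one_le_two
      calc _ ≤ 1 * |(j : ℝ)| * A * (C0 * m * D) + A * (C1 * m * D) := by gcongr
        _ ≤ _ := by
          have : 0 ≤ C0 * A * m * D := by positivity
          have : 0 ≤ C1 * |(j : ℝ)| * A * m * D := by positivity
          linarith

/-! ### Sums over scales and translates -/

lemma summable_int_inv_one_add_abs_sq : Summable fun m : ℤ => ((1 + |(m : ℝ)|) ^ 2)⁻¹ := by
  have h : Summable fun n : ℕ => ((1 + (n : ℝ)) ^ 2)⁻¹ := by
    have := (summable_nat_add_iff 1).2 (Real.summable_nat_pow_inv.2 (show 1 < 2 by norm_num))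
    refine this.congr fun n => ?_
    push_cast
    rw [add_comm]
  refine Summable.of_nat_of_neg ?_ ?_ <;> simpa using h

/-- The sums `∑ₖ (1 + |x - k|)⁻²` are bounded uniformly in `x`. -/
lemma exists_tsum_int_translate_le :
    ∃ K : ℝ, 0 ≤ K ∧ ∀ x : ℝ, (Summable fun k : ℤ => ((1 + |x - k|) ^ 2)⁻¹) ∧
      ∑' k : ℤ, ((1 + |x - k|) ^ 2)⁻¹ ≤ K := by
  refine ⟨∑' m : ℤ, 4 * ((1 + |(m : ℝ)|) ^ 2)⁻¹, tsum_nonneg fun m => by positivity, fun x => ?_⟩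
  have hs := summable_int_inv_one_add_abs_sq.mul_left 4
  have hle : ∀ m : ℤ, ((1 + |x - ((⌊x⌋ + m : ℤ) : ℝ)|) ^ 2)⁻¹ ≤ 4 * ((1 + |(m : ℝ)|) ^ 2)⁻¹ := by
    intro m
    have h1 : |(m : ℝ)| ≤ |x - ((⌊x⌋ + m : ℤ) : ℝ)| + 1 := by
      have e : (m : ℝ) = Int.fract x - (x - ((⌊x⌋ + m : ℤ) : ℝ)) := by
        rw [Int.fract]; push_cast; ring
      have hfr : |Int.fract x| ≤ 1 := by
        rw [abs_of_nonneg (Int.fract_nonneg x)]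
        exact (Int.fract_lt_one x).le
      calc |(m : ℝ)| = |Int.fract x - (x - ((⌊x⌋ + m : ℤ) : ℝ))| := by rw [← e]
        _ ≤ _ := by
          have := abs_sub (Int.fract x) (x - ((⌊x⌋ + m : ℤ) : ℝ))
          linarith
    have h2 : (1 + |(m : ℝ)|) / 2 ≤ 1 + |x - ((⌊x⌋ + m : ℤ) : ℝ)| := by
      linarith [abs_nonneg (x - ((⌊x⌋ + m : ℤ) : ℝ))]
    have h3 : ((1 + |x - ((⌊x⌋ + m : ℤ) : ℝ)|) ^ 2)⁻¹ ≤ (((1 + |(m : ℝ)|) / 2) ^ 2)⁻¹ := by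
      gcongr
    refine h3.trans (le_of_eq ?_)
    field_simp
    norm_num
  have hs' : Summable fun m : ℤ => ((1 + |x - ((⌊x⌋ + m : ℤ) : ℝ)|) ^ 2)⁻¹ :=
    Summable.of_nonneg_of_le (fun m => by positivity) hle hs
  constructor
  · exact ((Equiv.addLeft ⌊x⌋).summable_iff (f := fun k : ℤ => ((1 + |x - k|) ^ 2)⁻¹)).1 hs'
  · rw [← (Equiv.addLeft ⌊x⌋).tsum_eq (fun k : ℤ => ((1 + |x - k|) ^ 2)⁻¹)]
    exact hs'.tsum_le_tsum hle hs

lemma summable_int_sq_mul_two_rpow {κ : ℝ} (hκ : 0 < κ) :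
    Summable fun j : ℤ => (1 + |(j : ℝ)|) ^ 2 * (2 : ℝ) ^ (-(κ * |(j : ℝ)|)) := by
  set r : ℝ := (2 : ℝ) ^ (-κ) with hr
  have hr1 : ‖r‖ < 1 := by
    rw [Real.norm_of_nonneg (by positivity)]
    exact Real.rpow_lt_one_of_one_lt_of_neg one_lt_two (by linarith)
  have h : Summable fun n : ℕ => (1 + (n : ℝ)) ^ 2 * (2 : ℝ) ^ (-(κ * (n : ℝ))) := by
    have h2 := summable_pow_mul_geometric_of_norm_lt_one 2 hr1
    have h1 := summable_pow_mul_geometric_of_norm_lt_one 1 hr1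
    have h0 := summable_pow_mul_geometric_of_norm_lt_one 0 hr1
    refine ((h2.add (h1.mul_left 2)).add h0).congr fun n => ?_
    have : (2 : ℝ) ^ (-(κ * (n : ℝ))) = r ^ n := by
      rw [hr, ← Real.rpow_natCast, ← Real.rpow_mul (by norm_num)]
      ring_nf
    rw [this]
    ring
  refine Summable.of_nat_of_neg ?_ ?_ <;> simpa using h

/-- The summable family dominating the terms of all the wavelet series at the time `t`. -/
noncomputable def waveMajorant (κ t : ℝ) (p : ℤ × ℤ) : ℝ :=
  (1 + |(p.1 : ℝ)|) ^ 2 * (2 : ℝ) ^ (-(κ * |(p.1 : ℝ)|)) *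
    ((1 + |(2 : ℝ) ^ p.1 * t - p.2|) ^ 2)⁻¹

lemma waveMajorant_nonneg (κ t : ℝ) (p : ℤ × ℤ) : 0 ≤ waveMajorant κ t p := by
  unfold waveMajorant; positivity


lemma exists_tsum_waveMajorant_le {κ : ℝ} (hκ : 0 < κ) :
    ∃ K : ℝ, 0 ≤ K ∧ ∀ t : ℝ, Summable (waveMajorant κ t) ∧ ∑' p, waveMajorant κ t p ≤ K := by
  obtain ⟨K, hK, H⟩ := exists_tsum_int_translate_le
  have hj := summable_int_sq_mul_two_rpow hκ
  set G : ℤ → ℝ := fun j => (1 + |(j : ℝ)|) ^ 2 * (2 : ℝ) ^ (-(κ * |(j : ℝ)|)) with hG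
  have hj0 : ∀ j : ℤ, 0 ≤ G j := fun j => by rw [hG]; positivity
  have hjK := hj.mul_right K
  refine ⟨∑' j : ℤ, G j * K, tsum_nonneg fun j => mul_nonneg (hj0 j) hK, fun t => ?_⟩
  have hrow : ∀ j : ℤ, Summable fun k : ℤ => waveMajorant κ t (j, k) := fun j =>
    (H ((2 : ℝ) ^ j * t)).1.mul_left (G j)
  have hrow' : ∀ j : ℤ, ∑' k : ℤ, waveMajorant κ t (j, k) ≤ G j * K := fun j => by
    have e : ∑' k : ℤ, waveMajorant κ t (j, k) =
        G j * ∑' k : ℤ, ((1 + |(2 : ℝ) ^ j * t - k|) ^ 2)⁻¹ := by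
      rw [← tsum_mul_left]
      rfl
    rw [e]
    exact mul_le_mul_of_nonneg_left (H ((2 : ℝ) ^ j * t)).2 (hj0 j)
  have hcol : Summable fun j : ℤ => ∑' k : ℤ, waveMajorant κ t (j, k) :=
    Summable.of_nonneg_of_le (fun j => tsum_nonneg fun k => waveMajorant_nonneg κ t (j, k)) hrow'
      hjK
  have hs : Summable (waveMajorant κ t) :=
    (summable_prod_of_nonneg (f := waveMajorant κ t)
      fun p => waveMajorant_nonneg κ t p).2 ⟨hrow, hcol⟩
  refine ⟨hs, ?_⟩
  rw [hs.tsum_prod' hrow]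
  exact hcol.tsum_le_tsum hrow' hjK

/-! ### Bounds for the terms of the wavelet series -/

/-- The increment between the times `t₀` and `t₁` of `t ↦ 2^{-jθ} I(2^j t - k, θ)`, where
`I = annularInt f`. -/
noncomputable def waveIncr (f : ℝ → ℂ) (p : ℤ × ℤ) (t₁ t₀ θ : ℝ) : ℂ :=
  annularIncr f p.1 ((2 : ℝ) ^ p.1 * t₁ - p.2) ((2 : ℝ) ^ p.1 * t₀ - p.2) θ

lemma waveIncr_eq_sub (f : ℝ → ℂ) (p : ℤ × ℤ) (t₁ t₀ θ : ℝ) :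
    waveIncr f p t₁ t₀ θ = waveIncr f p t₁ 0 θ - waveIncr f p t₀ 0 θ := by
  unfold waveIncr annularIncr
  ring

/-- The growth allowed for the random coefficient of index `p = (j, k)`. -/
noncomputable def coeffWeight (δ : ℝ) (p : ℤ × ℤ) : ℝ :=
  (1 + |(p.1 : ℝ)|) * (1 + |(p.2 : ℝ)|) ^ δ

/-- The largest value of `2^{-js}` for `s ∈ [a, b]`. -/
noncomputable def scaleBound (a b : ℝ) (j : ℤ) : ℝ :=
  if 0 ≤ j then (2 : ℝ) ^ (-(j : ℝ) * a) else (2 : ℝ) ^ (-(j : ℝ) * b)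

lemma scaleBound_nonneg (a b : ℝ) (j : ℤ) : 0 ≤ scaleBound a b j := by
  unfold scaleBound; split_ifs <;> positivity

lemma le_scaleBound {a b s : ℝ} (j : ℤ) (hs : s ∈ Set.Icc a b) :
    (2 : ℝ) ^ (-(j : ℝ) * s) ≤ scaleBound a b j := by
  unfold scaleBound
  split_ifs with h
  · have : (0 : ℝ) ≤ j := by exact_mod_cast h
    exact Real.rpow_le_rpow_of_exponent_le one_le_two (by nlinarith [hs.1])
  · have : (j : ℝ) ≤ 0 := by exact_mod_cast (not_le.1 h).le
    exact Real.rpow_le_rpow_of_exponent_le one_le_two (by nlinarith [hs.2])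

lemma min_one_le_rpow {x γ : ℝ} (hx : 0 ≤ x) (hγ : γ ∈ Set.Icc (0 : ℝ) 1) : min 1 x ≤ x ^ γ := by
  rcases le_total 1 x with h | h
  · exact (min_le_left _ _).trans (Real.one_le_rpow h hγ.1)
  · refine (min_le_right _ _).trans ?_
    rcases hx.eq_or_lt with h0 | h0
    · rw [← h0]; exact Real.rpow_nonneg le_rfl _
    · simpa using Real.rpow_le_rpow_of_exponent_ge h0 h hγ.2

lemma le_mul_rpow_of_le {h N γ : ℝ} (h0 : 0 ≤ h) (hN : 1 ≤ N) (hle : h ≤ N)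
    (hγ : γ ∈ Set.Icc (0 : ℝ) 1) : h ≤ N * h ^ γ := by
  rcases h0.eq_or_lt with h0 | h0
  · rw [← h0]
    have := Real.rpow_nonneg (le_refl (0 : ℝ)) γ
    positivity
  · have e : h = h ^ (1 - γ) * h ^ γ := by
      rw [← Real.rpow_add h0]; simp
    have h1 : h ^ (1 - γ) ≤ N ^ (1 - γ) :=
      Real.rpow_le_rpow h0.le hle (by linarith [hγ.2])
    have h2 : N ^ (1 - γ) ≤ N := by
      simpa using Real.rpow_le_rpow_of_exponent_le hN (show 1 - γ ≤ 1 by linarith [hγ.1])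
    calc h = h ^ (1 - γ) * h ^ γ := e
      _ ≤ N * h ^ γ := by gcongr; exact h1.trans h2

/-- At coarse scales `j < 0` an increment gains a full power of its length. -/
lemma scaleBound_mul_min_le_of_neg {a b ρ h N γ : ℝ} {j : ℤ} (hj : j < 0) (hρb : ρ ≤ 1 - b)
    (h0 : 0 ≤ h) (hN : 1 ≤ N) (hle : h ≤ N) (hγ : γ ∈ Set.Icc (0 : ℝ) 1) :
    scaleBound a b j * min 1 ((2 : ℝ) ^ j * h) ≤
      N * h ^ γ * (2 : ℝ) ^ (-(ρ * |(j : ℝ)|)) := by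
  have hj' : (j : ℝ) < 0 := by exact_mod_cast hj
  have e : scaleBound a b j = (2 : ℝ) ^ (-(j : ℝ) * b) := by simp [scaleBound, hj]
  have h1 : (2 : ℝ) ^ (-(j : ℝ) * b) * (2 : ℝ) ^ j ≤ (2 : ℝ) ^ (-(ρ * |(j : ℝ)|)) := by
    rw [← Real.rpow_intCast, ← Real.rpow_add two_pos]
    refine Real.rpow_le_rpow_of_exponent_le one_le_two ?_
    rw [abs_of_neg hj']
    nlinarith
  rw [e]
  calc _ ≤ (2 : ℝ) ^ (-(j : ℝ) * b) * ((2 : ℝ) ^ j * h) := by gcongr; exact min_le_right _ _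
    _ = ((2 : ℝ) ^ (-(j : ℝ) * b) * (2 : ℝ) ^ j) * h := by ring
    _ ≤ (2 : ℝ) ^ (-(ρ * |(j : ℝ)|)) * (N * h ^ γ) := by
      gcongr
      exact le_mul_rpow_of_le h0 hN hle hγ
    _ = _ := by ring

/-- Interpolation: a power `γ` of the length of an increment costs `γ` in the decay across
scales. -/
lemma scaleBound_mul_min_le {a b ρ h N γ : ℝ} (j : ℤ) (hρa : ρ ≤ a) (hρb : ρ ≤ 1 - b)
    (h0 : 0 ≤ h) (hN : 1 ≤ N) (hle : h ≤ N) (hγ : γ ∈ Set.Icc (0 : ℝ) 1) :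
    scaleBound a b j * min 1 ((2 : ℝ) ^ j * h) ≤
      N * h ^ γ * (2 : ℝ) ^ (-((ρ - γ) * |(j : ℝ)|)) := by
  rcases lt_or_ge j 0 with hj | hj
  · refine (scaleBound_mul_min_le_of_neg hj hρb h0 hN hle hγ).trans ?_
    have : (2 : ℝ) ^ (-(ρ * |(j : ℝ)|)) ≤ (2 : ℝ) ^ (-((ρ - γ) * |(j : ℝ)|)) :=
      Real.rpow_le_rpow_of_exponent_le one_le_two
        (by nlinarith [abs_nonneg (j : ℝ), hγ.1])
    gcongr
  · have hj' : (0 : ℝ) ≤ j := by exact_mod_cast hj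
    have e : scaleBound a b j = (2 : ℝ) ^ (-(j : ℝ) * a) := by simp [scaleBound, hj]
    have h1 := min_one_le_rpow (show 0 ≤ (2 : ℝ) ^ j * h by positivity) hγ
    rw [Real.mul_rpow (by positivity) h0, ← Real.rpow_intCast, ← Real.rpow_mul (by norm_num)] at h1
    have h2 : (2 : ℝ) ^ (-(j : ℝ) * a) * (2 : ℝ) ^ ((j : ℝ) * γ) ≤
        (2 : ℝ) ^ (-((ρ - γ) * |(j : ℝ)|)) := by
      rw [← Real.rpow_add two_pos]
      refine Real.rpow_le_rpow_of_exponent_le one_le_two ?_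
      rw [abs_of_nonneg hj']
      nlinarith
    rw [e, ← Real.rpow_intCast]
    calc _ ≤ (2 : ℝ) ^ (-(j : ℝ) * a) * ((2 : ℝ) ^ ((j : ℝ) * γ) * h ^ γ) := by gcongr
      _ = ((2 : ℝ) ^ (-(j : ℝ) * a) * (2 : ℝ) ^ ((j : ℝ) * γ)) * (1 * h ^ γ) := by ring
      _ ≤ (2 : ℝ) ^ (-((ρ - γ) * |(j : ℝ)|)) * (N * h ^ γ) := by gcongr
      _ = _ := by ring

lemma one_add_abs_rpow_le {δ N t : ℝ} (p : ℤ × ℤ) (hδ : δ ∈ Set.Icc (0 : ℝ) 1) (hN : 0 ≤ N)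
    (ht : |t| ≤ N) : (1 + |(p.2 : ℝ)|) ^ δ ≤
      (1 + N) * (2 : ℝ) ^ (δ * |(p.1 : ℝ)|) * (1 + |(2 : ℝ) ^ p.1 * t - p.2|) := by
  obtain ⟨j, k⟩ := p
  simp only
  set x := (2 : ℝ) ^ j * t - k with hx
  have h2 : (2 : ℝ) ^ j ≤ (2 : ℝ) ^ |(j : ℝ)| := by
    rw [← Real.rpow_intCast]
    exact Real.rpow_le_rpow_of_exponent_le one_le_two (le_abs_self _)
  have h3 : (1 : ℝ) ≤ (2 : ℝ) ^ |(j : ℝ)| := Real.one_le_rpow one_le_two (abs_nonneg _)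
  have h1 : 1 + |(k : ℝ)| ≤ ((1 + N) * (2 : ℝ) ^ |(j : ℝ)|) * (1 + |x|) := by
    have e : (k : ℝ) = (2 : ℝ) ^ j * t - x := by rw [hx]; ring
    have : |(k : ℝ)| ≤ (2 : ℝ) ^ j * |t| + |x| := by
      rw [e]
      refine (abs_sub _ _).trans ?_
      rw [abs_mul, abs_of_nonneg (show (0 : ℝ) ≤ (2 : ℝ) ^ j by positivity)]
    have h4 : (2 : ℝ) ^ j * |t| ≤ (2 : ℝ) ^ |(j : ℝ)| * N := by gcongr
    have h5 : 0 ≤ ((1 + N) * (2 : ℝ) ^ |(j : ℝ)| - 1) * |x| :=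
      mul_nonneg (by nlinarith) (abs_nonneg _)
    nlinarith
  have hone : ∀ {y : ℝ}, 1 ≤ y → y ^ δ ≤ y := fun hy => by
    simpa using Real.rpow_le_rpow_of_exponent_le hy hδ.2
  calc (1 + |(k : ℝ)|) ^ δ ≤ (((1 + N) * (2 : ℝ) ^ |(j : ℝ)|) * (1 + |x|)) ^ δ :=
        Real.rpow_le_rpow (by positivity) h1 hδ.1
    _ = (1 + N) ^ δ * (2 : ℝ) ^ (δ * |(j : ℝ)|) * (1 + |x|) ^ δ := by
      rw [Real.mul_rpow (by positivity) (by positivity), Real.mul_rpow (by positivity)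
        (by positivity), ← Real.rpow_mul (by norm_num), mul_comm δ]
    _ ≤ _ := by
      gcongr
      · exact hone (by linarith)
      · exact hone (by linarith [abs_nonneg x])

/-- A coefficient of the allowed growth times a term that decays across scales and away from the
times `t₀` and `t₁` is dominated by a summable family. -/
lemma mul_le_waveMajorant {M B δ κ N t₁ t₀ e v : ℝ} (p : ℤ × ℤ) (hδ : δ ∈ Set.Icc (0 : ℝ) 1)
    (hN : 0 ≤ N) (h₁ : |t₁| ≤ N) (h₀ : |t₀| ≤ N) (hM : 0 ≤ M) (hB : 0 ≤ B)
    (he : |e| ≤ M * coeffWeight δ p)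
    (hv : |v| ≤ B * (1 + |(p.1 : ℝ)|) * (2 : ℝ) ^ (-((κ + δ) * |(p.1 : ℝ)|)) *
      (((1 + |(2 : ℝ) ^ p.1 * t₁ - p.2|) ^ 3)⁻¹ + ((1 + |(2 : ℝ) ^ p.1 * t₀ - p.2|) ^ 3)⁻¹)) :
    |e * v| ≤ M * (B * (1 + N)) * (waveMajorant κ t₁ p + waveMajorant κ t₀ p) := by
  have key : ∀ t, |t| ≤ N → (1 + |(p.2 : ℝ)|) ^ δ * (2 : ℝ) ^ (-((κ + δ) * |(p.1 : ℝ)|)) *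
      ((1 + |(2 : ℝ) ^ p.1 * t - p.2|) ^ 3)⁻¹ ≤
      (1 + N) * (2 : ℝ) ^ (-(κ * |(p.1 : ℝ)|)) * ((1 + |(2 : ℝ) ^ p.1 * t - p.2|) ^ 2)⁻¹ := by
    intro t ht
    have hx : 0 < 1 + |(2 : ℝ) ^ p.1 * t - p.2| := by positivity
    have e2 : (2 : ℝ) ^ (-(κ * |(p.1 : ℝ)|)) =
        (2 : ℝ) ^ (δ * |(p.1 : ℝ)|) * (2 : ℝ) ^ (-((κ + δ) * |(p.1 : ℝ)|)) := by
      rw [← Real.rpow_add two_pos]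
      ring_nf
    calc _ ≤ ((1 + N) * (2 : ℝ) ^ (δ * |(p.1 : ℝ)|) * (1 + |(2 : ℝ) ^ p.1 * t - p.2|)) *
          (2 : ℝ) ^ (-((κ + δ) * |(p.1 : ℝ)|)) * ((1 + |(2 : ℝ) ^ p.1 * t - p.2|) ^ 3)⁻¹ := by
          gcongr
          exact one_add_abs_rpow_le p hδ hN ht
      _ = _ := by
        rw [e2]
        field_simp
  rw [abs_mul]
  have k1 := key t₁ h₁
  have k0 := key t₀ h₀
  calc |e| * |v| ≤ (M * coeffWeight δ p) * _ := mul_le_mul he hv (abs_nonneg _) (by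
        unfold coeffWeight; positivity)
    _ = M * B * (1 + |(p.1 : ℝ)|) ^ 2 * (((1 + |(p.2 : ℝ)|) ^ δ *
          (2 : ℝ) ^ (-((κ + δ) * |(p.1 : ℝ)|)) * ((1 + |(2 : ℝ) ^ p.1 * t₁ - p.2|) ^ 3)⁻¹) +
          ((1 + |(p.2 : ℝ)|) ^ δ *
          (2 : ℝ) ^ (-((κ + δ) * |(p.1 : ℝ)|)) * ((1 + |(2 : ℝ) ^ p.1 * t₀ - p.2|) ^ 3)⁻¹)) := by
        unfold coeffWeight; ring
    _ ≤ M * B * (1 + |(p.1 : ℝ)|) ^ 2 * ((1 + N) * (2 : ℝ) ^ (-(κ * |(p.1 : ℝ)|)) *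
          ((1 + |(2 : ℝ) ^ p.1 * t₁ - p.2|) ^ 2)⁻¹ + (1 + N) * (2 : ℝ) ^ (-(κ * |(p.1 : ℝ)|)) *
          ((1 + |(2 : ℝ) ^ p.1 * t₀ - p.2|) ^ 2)⁻¹) := by gcongr
    _ = _ := by unfold waveMajorant; ring

lemma inv_one_add_abs_pow_four_le (x : ℝ) : ((1 + |x|) ^ 4)⁻¹ ≤ ((1 + |x|) ^ 3)⁻¹ := by
  have : (1 : ℝ) ≤ 1 + |x| := by linarith [abs_nonneg x]
  gcongr
  norm_num

lemma abs_two_zpow_mul_sub (j k : ℤ) (t₁ t₀ : ℝ) :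
    |((2 : ℝ) ^ j * t₁ - k) - ((2 : ℝ) ^ j * t₀ - k)| = (2 : ℝ) ^ j * |t₁ - t₀| := by
  rw [show ((2 : ℝ) ^ j * t₁ - k) - ((2 : ℝ) ^ j * t₀ - k) = (2 : ℝ) ^ j * (t₁ - t₀) by ring,
    abs_mul, abs_of_nonneg (show (0 : ℝ) ≤ (2 : ℝ) ^ j by positivity)]

/-- The gain from an exponent that is frozen at the dyadic point `k / 2^j` rather than at `t₀`:
its distance to the exponent at `t₀` is at most `c |k / 2^j - t₀|^d`, which recovers the full power
`d` of `|t₁ - t₀|` at every scale without any loss in the decay across scales. -/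
lemma abs_sub_mul_scaleBound_mul_min_le {a b ρ c d N t₁ t₀ u : ℝ} (p : ℤ × ℤ)
    (hρa : ρ ≤ a) (hρb : ρ ≤ 1 - b) (hd : d ∈ Set.Icc (0 : ℝ) 1)
    (hN : 1 ≤ N) (hle : |t₁ - t₀| ≤ N) (hc : 1 ≤ c) (_hu0 : 0 ≤ u) (hu1 : u ≤ 1)
    (hu : u ≤ c * |(p.2 : ℝ) / (2 : ℝ) ^ p.1 - t₀| ^ d) :
    u * (scaleBound a b p.1 * min 1 ((2 : ℝ) ^ p.1 * |t₁ - t₀|)) ≤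
        2 * c * N * |t₁ - t₀| ^ d * (2 : ℝ) ^ (-(ρ * |(p.1 : ℝ)|)) *
          (1 + |(2 : ℝ) ^ p.1 * t₁ - p.2|) ∧
    u * (scaleBound a b p.1 * min 1 ((2 : ℝ) ^ p.1 * |t₁ - t₀|)) ≤
        2 * c * N * |t₁ - t₀| ^ d * (2 : ℝ) ^ (-(ρ * |(p.1 : ℝ)|)) *
          (1 + |(2 : ℝ) ^ p.1 * t₀ - p.2|) := by
  obtain ⟨j, k⟩ := p
  simp only at hu ⊢
  set h := |t₁ - t₀| with hh
  have h0 : 0 ≤ h := abs_nonneg _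
  have hhd : 0 ≤ h ^ d := Real.rpow_nonneg h0 d
  set m := min 1 ((2 : ℝ) ^ j * h) with hm
  have hm0 : 0 ≤ m := le_min zero_le_one (by positivity)
  have hm1 : m ≤ 1 := min_le_left _ _
  have hA := scaleBound_nonneg a b j
  set G := (2 : ℝ) ^ (-(ρ * |(j : ℝ)|)) with hG
  have hG0 : 0 < G := by positivity
  rcases lt_or_ge j 0 with hj | hj
  · have h1 := scaleBound_mul_min_le_of_neg (a := a) hj hρb h0 hN hle hd
    have h2 : u * (scaleBound a b j * m) ≤ 2 * c * N * h ^ d * G := by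
      calc _ ≤ 1 * (N * h ^ d * G) := by gcongr
        _ ≤ (2 * c) * (N * h ^ d * G) := by gcongr; linarith
        _ = _ := by ring
    have h3 : ∀ y : ℝ, 2 * c * N * h ^ d * G ≤ 2 * c * N * h ^ d * G * (1 + |y|) := fun y =>
      le_mul_of_one_le_right (by positivity) (by linarith [abs_nonneg y])
    exact ⟨h2.trans (h3 _), h2.trans (h3 _)⟩
  · have hj' : (0 : ℝ) ≤ j := by exact_mod_cast hj
    have hAG : scaleBound a b j ≤ G := by
      have e : scaleBound a b j = (2 : ℝ) ^ (-(j : ℝ) * a) := by simp [scaleBound, hj]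
      rw [e, hG]
      refine Real.rpow_le_rpow_of_exponent_le one_le_two ?_
      rw [abs_of_nonneg hj']
      nlinarith
    have h2j : (0 : ℝ) < (2 : ℝ) ^ j := by positivity
    have hone : ∀ y : ℝ, |y| ^ d ≤ 1 + |y| := fun y => by
      have h1 : |y| ^ d ≤ (1 + |y|) ^ d :=
        Real.rpow_le_rpow (abs_nonneg _) (by linarith [abs_nonneg y]) hd.1
      have h2 : (1 + |y|) ^ d ≤ 1 + |y| := by
        simpa using Real.rpow_le_rpow_of_exponent_le
          (show 1 ≤ 1 + |y| by linarith [abs_nonneg y]) hd.2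
      exact h1.trans h2
    have hmd : m ≤ ((2 : ℝ) ^ j) ^ d * h ^ d := by
      rw [← Real.mul_rpow h2j.le h0]
      exact min_one_le_rpow (by positivity) hd
    -- `|y / 2^j|^d m ≤ (1 + |y|) h^d`
    have hy : ∀ y : ℝ, (|y| / (2 : ℝ) ^ j) ^ d * m ≤ (1 + |y|) * h ^ d := fun y => by
      rw [Real.div_rpow (abs_nonneg _) h2j.le]
      have hp : 0 < ((2 : ℝ) ^ j) ^ d := Real.rpow_pos_of_pos h2j d
      calc |y| ^ d / ((2 : ℝ) ^ j) ^ d * m ≤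
            |y| ^ d / ((2 : ℝ) ^ j) ^ d * (((2 : ℝ) ^ j) ^ d * h ^ d) := by gcongr
        _ = |y| ^ d * h ^ d := by field_simp
        _ ≤ _ := by gcongr; exact hone y
    have hdist : |(k : ℝ) / (2 : ℝ) ^ j - t₀| = |(2 : ℝ) ^ j * t₀ - k| / (2 : ℝ) ^ j := by
      rw [show (k : ℝ) / (2 : ℝ) ^ j - t₀ = -(((2 : ℝ) ^ j * t₀ - k) / (2 : ℝ) ^ j) by
        field_simp; ring, abs_neg, abs_div, abs_of_pos h2j]
    have hdist' : |(k : ℝ) / (2 : ℝ) ^ j - t₀| ≤ |(2 : ℝ) ^ j * t₁ - k| / (2 : ℝ) ^ j + h := by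
      rw [show (k : ℝ) / (2 : ℝ) ^ j - t₀ = -(((2 : ℝ) ^ j * t₁ - k) / (2 : ℝ) ^ j) + (t₁ - t₀) by
        field_simp; ring]
      refine (abs_add_le _ _).trans ?_
      rw [abs_neg, abs_div, abs_of_pos h2j]
    have comb : ∀ y : ℝ, u * m ≤ 2 * c * h ^ d * (1 + |y|) →
        u * (scaleBound a b j * m) ≤ 2 * c * N * h ^ d * G * (1 + |y|) := fun y hum => by
      calc u * (scaleBound a b j * m) = (u * m) * scaleBound a b j := by ring
        _ ≤ (2 * c * h ^ d * (1 + |y|)) * G := by gcongr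
        _ = 2 * c * 1 * h ^ d * G * (1 + |y|) := by ring
        _ ≤ _ := by gcongr
    refine ⟨comb _ ?_, comb _ ?_⟩
    · have e1 : u ≤ c * ((|(2 : ℝ) ^ j * t₁ - k| / (2 : ℝ) ^ j) ^ d + h ^ d) := by
        refine hu.trans ?_
        gcongr
        exact (Real.rpow_le_rpow (abs_nonneg _) hdist' hd.1).trans
          (Real.rpow_add_le_add_rpow (by positivity) h0 hd.1 hd.2)
      calc u * m ≤ c * ((|(2 : ℝ) ^ j * t₁ - k| / (2 : ℝ) ^ j) ^ d + h ^ d) * m := by gcongr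
        _ = c * ((|(2 : ℝ) ^ j * t₁ - k| / (2 : ℝ) ^ j) ^ d * m + h ^ d * m) := by ring
        _ ≤ c * ((1 + |(2 : ℝ) ^ j * t₁ - k|) * h ^ d + h ^ d * 1) := by
          refine mul_le_mul_of_nonneg_left (add_le_add (hy _) ?_) (by linarith)
          gcongr
        _ ≤ _ := by
          have : 0 ≤ c * h ^ d * |(2 : ℝ) ^ j * t₁ - k| := by positivity
          linarith
    · calc u * m ≤ c * (|(2 : ℝ) ^ j * t₀ - k| / (2 : ℝ) ^ j) ^ d * m := by
            rw [hdist] at hu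
            gcongr
        _ = c * ((|(2 : ℝ) ^ j * t₀ - k| / (2 : ℝ) ^ j) ^ d * m) := by ring
        _ ≤ c * ((1 + |(2 : ℝ) ^ j * t₀ - k|) * h ^ d) :=
          mul_le_mul_of_nonneg_left (hy _) (by linarith)
        _ ≤ _ := by
          have : 0 ≤ c * h ^ d * (1 + |(2 : ℝ) ^ j * t₀ - k|) := by positivity
          linarith

/-- The three bounds for the terms of the wavelet series: for increments in time, for the dependence
on the exponent, and for increments in time of the difference between two exponents of which one is
frozen at a dyadic point. -/
lemma IsAnnular.exists_waveIncr_bounds {f : ℝ → ℂ} (hf : IsAnnular f) {a b ρ N : ℝ}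
    (ha : 0 < a) (hb : b < 1) (hρ0 : 0 < ρ) (hρa : ρ ≤ a) (hρb : ρ ≤ 1 - b) (hab : a ≤ b)
    (hN : 1 ≤ N) :
    ∃ C : ℝ, 0 ≤ C ∧ ∀ (M e : ℝ) (p : ℤ × ℤ) (t₁ t₀ : ℝ), 0 ≤ M → |e| ≤ M * coeffWeight (ρ / 4) p →
      |t₁| ≤ N → |t₀| ≤ N →
      (∀ θ ∈ Set.Icc a b, |e * (waveIncr f p t₁ t₀ θ).re| ≤
        M * (C * |t₁ - t₀| ^ (ρ / 4)) *
          (waveMajorant (ρ / 2) t₁ p + waveMajorant (ρ / 2) t₀ p)) ∧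
      (∀ θ ∈ Set.Icc a b, ∀ θ' ∈ Set.Icc a b,
        |e * ((waveIncr f p t₁ t₀ θ).re - (waveIncr f p t₁ t₀ θ').re)| ≤
        M * (C * |θ - θ'|) *
          (waveMajorant (ρ / 2) t₁ p + waveMajorant (ρ / 2) t₀ p)) ∧
      (∀ θ ∈ Set.Icc a b, ∀ θ' ∈ Set.Icc a b, ∀ c d : ℝ, 1 ≤ c → d ∈ Set.Icc (0 : ℝ) 1 →
        |θ - θ'| ≤ c * |(p.2 : ℝ) / (2 : ℝ) ^ p.1 - t₀| ^ d →
        |e * ((waveIncr f p t₁ t₀ θ).re - (waveIncr f p t₁ t₀ θ').re)| ≤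
        M * (C * (c * |t₁ - t₀| ^ d)) *
          (waveMajorant (ρ / 2) t₁ p + waveMajorant (ρ / 2) t₀ p)) := by
  obtain ⟨C, hC, H⟩ := hf.exists_norm_annularIncr_le
  have hρ1 : ρ ≤ 1 := by linarith
  have hδ : ρ / 4 ∈ Set.Icc (0 : ℝ) 1 := ⟨by linarith, by linarith⟩
  refine ⟨C * (4 * N) * (1 + N), by positivity, fun M e p t₁ t₀ hM he h₁ h₀ => ?_⟩
  obtain ⟨D1, D2⟩ := H a b (scaleBound a b p.1) p.1 ha.le hb.le
    (fun s hs => le_scaleBound p.1 hs) ((2 : ℝ) ^ p.1 * t₁ - p.2) ((2 : ℝ) ^ p.1 * t₀ - p.2)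
  rw [abs_two_zpow_mul_sub] at D1 D2
  have hh : |t₁ - t₀| ≤ 2 * N := (abs_sub _ _).trans (by linarith)
  have h2N : 1 ≤ 2 * N := by linarith
  have hexp : ∀ σ : ℝ, 3 / 4 * ρ ≤ σ → (2 : ℝ) ^ (-(σ * |(p.1 : ℝ)|)) ≤
      (2 : ℝ) ^ (-((ρ / 2 + ρ / 4) * |(p.1 : ℝ)|)) := fun σ hσ =>
    Real.rpow_le_rpow_of_exponent_le one_le_two (by nlinarith [abs_nonneg (p.1 : ℝ)])
  have i1 := inv_one_add_abs_pow_four_le ((2 : ℝ) ^ p.1 * t₁ - p.2)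
  have i0 := inv_one_add_abs_pow_four_le ((2 : ℝ) ^ p.1 * t₀ - p.2)
  have hj1 : 1 ≤ 1 + |(p.1 : ℝ)| := by linarith [abs_nonneg (p.1 : ℝ)]
  have hred : ∀ y : ℝ, (1 + |y|) * ((1 + |y|) ^ 4)⁻¹ = ((1 + |y|) ^ 3)⁻¹ := fun y => by
    have : 1 + |y| ≠ 0 := by positivity
    field_simp
  refine ⟨fun θ hθ => ?_, fun θ hθ θ' hθ' => ?_, fun θ hθ θ' hθ' c d hc hd hu => ?_⟩
  · have hg := scaleBound_mul_min_le (a := a) (b := b) (γ := ρ / 4) p.1 hρa hρb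
      (abs_nonneg (t₁ - t₀)) h2N hh hδ
    have hpw : 0 ≤ |t₁ - t₀| ^ (ρ / 4) := Real.rpow_nonneg (abs_nonneg _) _
    refine (mul_le_waveMajorant (κ := ρ / 2) (B := C * (4 * N) * |t₁ - t₀| ^ (ρ / 4)) p hδ
      (by linarith) h₁ h₀ hM (by positivity) he ?_).trans (le_of_eq (by ring))
    refine (Complex.abs_re_le_norm _).trans ((D1 θ hθ).trans ?_)
    have hE := hexp (ρ - ρ / 4) (by linarith)
    set S := scaleBound a b p.1 * min 1 ((2 : ℝ) ^ p.1 * |t₁ - t₀|) with hS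
    calc _ = C * S *
          (((1 + |(2 : ℝ) ^ p.1 * t₁ - p.2|) ^ 4)⁻¹ + ((1 + |(2 : ℝ) ^ p.1 * t₀ - p.2|) ^ 4)⁻¹) := by
            rw [hS]; ring
      _ ≤ C * ((2 * N) * |t₁ - t₀| ^ (ρ / 4) *
            (2 : ℝ) ^ (-((ρ / 2 + ρ / 4) * |(p.1 : ℝ)|))) *
          (((1 + |(2 : ℝ) ^ p.1 * t₁ - p.2|) ^ 3)⁻¹ + ((1 + |(2 : ℝ) ^ p.1 * t₀ - p.2|) ^ 3)⁻¹) := by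
            gcongr
            refine hg.trans ?_
            gcongr
      _ = C * (2 * N) * |t₁ - t₀| ^ (ρ / 4) * 1 *
            (2 : ℝ) ^ (-((ρ / 2 + ρ / 4) * |(p.1 : ℝ)|)) *
          (((1 + |(2 : ℝ) ^ p.1 * t₁ - p.2|) ^ 3)⁻¹ + ((1 + |(2 : ℝ) ^ p.1 * t₀ - p.2|) ^ 3)⁻¹) := by
            ring
      _ ≤ _ := by
        gcongr
        norm_num
  · have hg := scaleBound_mul_min_le (a := a) (b := b) (γ := 0) p.1 hρa hρb
      (abs_nonneg (t₁ - t₀)) h2N hh ⟨le_rfl, zero_le_one⟩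
    rw [Real.rpow_zero, mul_one, sub_zero] at hg
    refine (mul_le_waveMajorant (κ := ρ / 2) (B := C * (4 * N) * |θ - θ'|) p hδ
      (by linarith) h₁ h₀ hM (by positivity) he ?_).trans (le_of_eq (by ring))
    rw [← Complex.sub_re]
    refine (Complex.abs_re_le_norm _).trans ((D2 θ hθ θ' hθ').trans ?_)
    have hE := hexp ρ (by linarith)
    set S := scaleBound a b p.1 * min 1 ((2 : ℝ) ^ p.1 * |t₁ - t₀|) with hS
    calc _ = C * |θ - θ'| * (1 + |(p.1 : ℝ)|) * S *
          (((1 + |(2 : ℝ) ^ p.1 * t₁ - p.2|) ^ 4)⁻¹ + ((1 + |(2 : ℝ) ^ p.1 * t₀ - p.2|) ^ 4)⁻¹) := by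
            rw [hS]; ring
      _ ≤ C * |θ - θ'| * (1 + |(p.1 : ℝ)|) * ((4 * N) *
            (2 : ℝ) ^ (-((ρ / 2 + ρ / 4) * |(p.1 : ℝ)|))) *
          (((1 + |(2 : ℝ) ^ p.1 * t₁ - p.2|) ^ 3)⁻¹ + ((1 + |(2 : ℝ) ^ p.1 * t₀ - p.2|) ^ 3)⁻¹) := by
            gcongr
            refine hg.trans ?_
            gcongr
            norm_num
      _ = _ := by ring
  · have hu1 : |θ - θ'| ≤ 1 := by
      rw [abs_le]
      constructor <;> linarith [hθ.1, hθ.2, hθ'.1, hθ'.2]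
    obtain ⟨g1, g0⟩ := abs_sub_mul_scaleBound_mul_min_le (a := a) (b := b) (t₁ := t₁) p hρa hρb hd
      h2N hh hc (abs_nonneg (θ - θ')) hu1 hu
    have hpw : 0 ≤ |t₁ - t₀| ^ d := Real.rpow_nonneg (abs_nonneg _) _
    refine (mul_le_waveMajorant (κ := ρ / 2) (B := C * (4 * N) * (c * |t₁ - t₀| ^ d)) p hδ
      (by linarith) h₁ h₀ hM (by positivity) he ?_).trans (le_of_eq (by ring))
    rw [← Complex.sub_re]
    refine (Complex.abs_re_le_norm _).trans ((D2 θ hθ θ' hθ').trans ?_)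
    have hE := hexp ρ (by linarith)
    set S := |θ - θ'| * (scaleBound a b p.1 * min 1 ((2 : ℝ) ^ p.1 * |t₁ - t₀|)) with hS
    calc _ = C * (1 + |(p.1 : ℝ)|) *
          (S * ((1 + |(2 : ℝ) ^ p.1 * t₁ - p.2|) ^ 4)⁻¹ +
            S * ((1 + |(2 : ℝ) ^ p.1 * t₀ - p.2|) ^ 4)⁻¹) := by
            rw [hS]; ring
      _ ≤ C * (1 + |(p.1 : ℝ)|) *
          (2 * c * (2 * N) * |t₁ - t₀| ^ d * (2 : ℝ) ^ (-(ρ * |(p.1 : ℝ)|)) *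
            (1 + |(2 : ℝ) ^ p.1 * t₁ - p.2|) * ((1 + |(2 : ℝ) ^ p.1 * t₁ - p.2|) ^ 4)⁻¹ +
          2 * c * (2 * N) * |t₁ - t₀| ^ d * (2 : ℝ) ^ (-(ρ * |(p.1 : ℝ)|)) *
            (1 + |(2 : ℝ) ^ p.1 * t₀ - p.2|) * ((1 + |(2 : ℝ) ^ p.1 * t₀ - p.2|) ^ 4)⁻¹) := by
            gcongr
      _ = C * (4 * N) * (c * |t₁ - t₀| ^ d) * (1 + |(p.1 : ℝ)|) *
            (2 : ℝ) ^ (-(ρ * |(p.1 : ℝ)|)) *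
          (((1 + |(2 : ℝ) ^ p.1 * t₁ - p.2|) ^ 3)⁻¹ + ((1 + |(2 : ℝ) ^ p.1 * t₀ - p.2|) ^ 3)⁻¹) := by
            rw [← hred, ← hred]; ring
      _ ≤ _ := by
        gcongr

/-! ### Gaussian coefficients and the isometry of the white noise -/

lemma summable_coeffWeight_inv_rpow {δ q : ℝ} (hδ : 2 ≤ δ * q) (hq : 2 ≤ q) :
    Summable fun p : ℤ × ℤ => ((coeffWeight δ p)⁻¹) ^ q := by
  have h := summable_int_inv_one_add_abs_sq.mul_of_nonneg summable_int_inv_one_add_abs_sq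
    (fun m => by positivity) (fun m => by positivity)
  refine Summable.of_nonneg_of_le (fun p => ?_) (fun p => ?_) h
  · unfold coeffWeight; positivity
  · have hj : 1 ≤ 1 + |(p.1 : ℝ)| := by linarith [abs_nonneg (p.1 : ℝ)]
    have hk : 1 ≤ 1 + |(p.2 : ℝ)| := by linarith [abs_nonneg (p.2 : ℝ)]
    unfold coeffWeight
    rw [Real.inv_rpow (by positivity), Real.mul_rpow (by positivity) (by positivity),
      ← Real.rpow_mul (by positivity), mul_inv]
    gcongr
    · rw [← Real.rpow_natCast]
      exact Real.rpow_le_rpow_of_exponent_le hj (by exact_mod_cast hq)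
    · rw [← Real.rpow_natCast]
      exact Real.rpow_le_rpow_of_exponent_le hk (by exact_mod_cast hδ)

lemma coeffWeight_pos (δ : ℝ) (p : ℤ × ℤ) : 0 < coeffWeight δ p := by
  unfold coeffWeight; positivity

section WhiteNoise

variable {Ω : Type*} [MeasurableSpace Ω] {P : Measure Ω}

/-- Standard Gaussian variables indexed by `ℤ × ℤ`, with arbitrary dependence, grow at most like
`coeffWeight δ`, up to a random factor with moments of every order. -/
lemma exists_coeff_bound [IsProbabilityMeasure P] {V : ℤ × ℤ → Ω → ℝ}
    (hV : ∀ p, AEMeasurable (V p) P) (hlaw : ∀ p, P.map (V p) = gaussianReal 0 1)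
    {δ : ℝ} (hδ : 0 < δ) :
    ∃ M : Ω → ℝ, Measurable M ∧ (∀ ω, 0 ≤ M ω) ∧ (∀ q : ℝ≥0, MemLp M q P) ∧
      ∀ᵐ ω ∂P, ∀ p, |V p ω| ≤ M ω * coeffWeight δ p := by
  set F : ℤ × ℤ → Ω → ENNReal := fun p ω =>
    ENNReal.ofReal (coeffWeight δ p)⁻¹ * ‖(hV p).mk (V p) ω‖ₑ with hF
  have hFm : ∀ p, Measurable (F p) := fun p => (hV p).measurable_mk.enorm.const_mul _
  set S : Ω → ENNReal := fun ω => ⨆ p, F p ω with hS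
  have hSm : Measurable S := Measurable.iSup hFm
  have hmom : ∀ q : ℝ≥0, 2 ≤ δ * q → 2 ≤ (q : ℝ) → ∫⁻ ω, S ω ^ (q : ℝ) ∂P < ⊤ := by
    intro q h1 h2
    have hq0 : (0 : ℝ) < q := by linarith
    have hle : ∀ ω, S ω ^ (q : ℝ) ≤ ∑' p, F p ω ^ (q : ℝ) := by
      intro ω
      have : S ω ≤ (∑' p, F p ω ^ (q : ℝ)) ^ (1 / (q : ℝ)) := by
        refine iSup_le fun p => ?_
        rw [one_div, ENNReal.le_rpow_inv_iff hq0]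
        exact ENNReal.le_tsum (f := fun p => F p ω ^ (q : ℝ)) p
      rwa [one_div, ENNReal.le_rpow_inv_iff hq0] at this
    set K := ∫⁻ x, ‖x‖ₑ ^ (q : ℝ) ∂(gaussianReal 0 1) with hK
    have hKtop : K < ⊤ := by
      have := (memLp_id_gaussianReal (μ := 0) (v := 1) q).2
      have h := lintegral_rpow_enorm_lt_top_of_eLpNorm_lt_top (by exact_mod_cast hq0.ne')
        ENNReal.coe_ne_top this
      simpa using h
    have hint : ∀ p, ∫⁻ ω, F p ω ^ (q : ℝ) ∂P =
        ENNReal.ofReal (((coeffWeight δ p)⁻¹) ^ (q : ℝ)) * K := by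
      intro p
      have e : ∀ ω, F p ω ^ (q : ℝ) = ENNReal.ofReal (((coeffWeight δ p)⁻¹) ^ (q : ℝ)) *
          ‖(hV p).mk (V p) ω‖ₑ ^ (q : ℝ) := fun ω => by
        rw [hF]
        simp only
        rw [ENNReal.mul_rpow_of_nonneg _ _ hq0.le,
          ENNReal.ofReal_rpow_of_pos (inv_pos.2 (coeffWeight_pos δ p))]
      simp_rw [e]
      rw [lintegral_const_mul _ ((hV p).measurable_mk.enorm.pow_const _), hK, ← hlaw p,
        Measure.map_congr (hV p).ae_eq_mk, lintegral_map (by fun_prop) (hV p).measurable_mk]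
    calc ∫⁻ ω, S ω ^ (q : ℝ) ∂P ≤ ∫⁻ ω, ∑' p, F p ω ^ (q : ℝ) ∂P := lintegral_mono hle
      _ = ∑' p, ENNReal.ofReal (((coeffWeight δ p)⁻¹) ^ (q : ℝ)) * K := by
        rw [lintegral_tsum fun p => ((hFm p).pow_const _).aemeasurable]
        simp_rw [hint]
      _ < ⊤ := by
        rw [ENNReal.tsum_mul_right]
        exact ENNReal.mul_lt_top
          (summable_coeffWeight_inv_rpow h1 h2).tsum_ofReal_lt_top hKtop
  have hlarge : ∀ r : ℝ≥0, ∃ q : ℝ≥0, r ≤ q ∧ 2 ≤ δ * q ∧ 2 ≤ (q : ℝ) := by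
    intro r
    refine ⟨max r (max (Real.toNNReal (2 / δ)) 2), le_max_left _ _, ?_, ?_⟩
    · have : 2 / δ ≤ ((max r (max (Real.toNNReal (2 / δ)) 2) : ℝ≥0) : ℝ) := by
        push_cast
        exact le_max_of_le_right (le_max_of_le_left (Real.le_coe_toNNReal _))
      rw [div_le_iff₀ hδ] at this
      linarith
    · push_cast
      exact le_max_of_le_right (le_max_right _ _)
  refine ⟨fun ω => (S ω).toReal, hSm.ennreal_toReal, fun ω => ENNReal.toReal_nonneg, fun r => ?_, ?_⟩
  · obtain ⟨q, hrq, h1, h2⟩ := hlarge r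
    refine MemLp.mono_exponent (q := (q : ENNReal)) ⟨hSm.ennreal_toReal.aestronglyMeasurable, ?_⟩
      (by exact_mod_cast hrq)
    have hq0 : (q : ENNReal) ≠ 0 := by
      have : (0 : ℝ) < q := by linarith
      exact_mod_cast this.ne'
    rw [eLpNorm_lt_top_iff_lintegral_rpow_enorm_lt_top hq0 ENNReal.coe_ne_top]
    refine lt_of_le_of_lt (lintegral_mono fun ω => ?_) (hmom q h1 h2)
    rw [ENNReal.coe_toReal]
    refine ENNReal.rpow_le_rpow ?_ q.2
    rw [Real.enorm_of_nonneg ENNReal.toReal_nonneg]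
    exact ENNReal.ofReal_toReal_le
  · obtain ⟨q, -, h1, h2⟩ := hlarge 0
    have hfin := ae_lt_top (hSm.pow_const (q : ℝ)) (hmom q h1 h2).ne
    filter_upwards [hfin, ae_all_iff.2 fun p => (hV p).ae_eq_mk] with ω hω hmk p
    have hq0 : (0 : ℝ) < q := by linarith
    have hSω : S ω ≠ ⊤ := by
      intro h
      rw [h, ENNReal.top_rpow_of_pos hq0] at hω
      exact lt_irrefl _ hω
    have hle : F p ω ≤ S ω := le_iSup (fun p => F p ω) p
    have h3 := ENNReal.toReal_mono hSω hle
    rw [hF] at h3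
    simp only at h3
    rw [← hmk p, ENNReal.toReal_mul, ENNReal.toReal_ofReal (inv_pos.2 (coeffWeight_pos δ p)).le,
      toReal_enorm, Real.norm_eq_abs, inv_mul_le_iff₀ (coeffWeight_pos δ p)] at h3
    linarith

/-- A series that converges in `Lᵖ` and converges pointwise almost everywhere has the same sum in
both senses. -/
lemma ae_eq_tsum_of_hasSum_Lp {g : ℤ × ℤ → Lp ℝ 2 P} {G : Lp ℝ 2 P} (h : HasSum g G)
    (hs : ∀ᵐ ω ∂P, Summable fun p => g p ω) : ∀ᵐ ω ∂P, G ω = ∑' p, g p ω := by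
  obtain ⟨e⟩ := nonempty_equiv_of_countable (α := ℕ) (β := ℤ × ℤ)
  have h' : HasSum (fun n => g (e n)) G := e.hasSum_iff.2 h
  have B : ∀ᵐ x ∂P, ∀ n, (∑ i ∈ Finset.range n, g (e i) : Lp ℝ 2 P) x =
      ∑ i ∈ Finset.range n, g (e i) x := by
    rw [ae_all_iff]
    exact fun i => Lp.coeFn_fun_finsetSum _ _
  obtain ⟨ns, hns, nslim⟩ :=
    (tendstoInMeasure_of_tendsto_Lp h'.tendsto_sum_nat).exists_seq_tendsto_ae
  filter_upwards [hs, B, nslim] with ω hω hB hlim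
  have h1 : HasSum (fun n => g (e n) ω) (∑' p, g p ω) := e.hasSum_iff.2 hω.hasSum
  have h2 := h1.tendsto_sum_nat.comp hns.tendsto_atTop
  refine tendsto_nhds_unique hlim (h2.congr fun n => ?_)
  simp only [Function.comp]
  rw [hB]

namespace IsWhiteNoise

variable {W : Lp ℝ 2 (volume : Measure ℝ) → Ω → ℝ}

lemma memLp_two (hW : IsWhiteNoise P W) (f : Lp ℝ 2 (volume : Measure ℝ)) : MemLp (W f) 2 P :=
  (hW.isGaussianProcess.hasGaussianLaw_eval f).memLp_two

lemma map_eq_gaussianReal (hW : IsWhiteNoise P W) {f : Lp ℝ 2 (volume : Measure ℝ)}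
    (hf : ‖f‖ = 1) : P.map (W f) = gaussianReal 0 1 := by
  rw [(hW.isGaussianProcess.hasGaussianLaw_eval f).map_eq_gaussianReal, hW.mean_zero,
    variance_eq_integral (hW.isGaussianProcess.aemeasurable f), hW.mean_zero]
  have : ∫ ω, (W f ω - 0) ^ 2 ∂P = 1 := by
    have := hW.covariance f f
    rw [real_inner_self_eq_norm_sq, hf] at this
    simpa [sq] using this
  rw [this]
  simp

/-- The variable `W f` as an element of `L²(Ω)`. -/
noncomputable def toLp (hW : IsWhiteNoise P W) (f : Lp ℝ 2 (volume : Measure ℝ)) : Lp ℝ 2 P :=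
  (hW.memLp_two f).toLp

lemma coeFn_toLp (hW : IsWhiteNoise P W) (f : Lp ℝ 2 (volume : Measure ℝ)) :
    hW.toLp f =ᵐ[P] W f := (hW.memLp_two f).coeFn_toLp

lemma inner_toLp (hW : IsWhiteNoise P W) (f g : Lp ℝ 2 (volume : Measure ℝ)) :
    inner ℝ (hW.toLp f) (hW.toLp g) = inner ℝ f g := by
  rw [L2.inner_def, ← hW.covariance f g]
  refine integral_congr_ae ?_
  filter_upwards [hW.coeFn_toLp f, hW.coeFn_toLp g] with ω h1 h2
  rw [h1, h2]
  simp [mul_comm]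

/-- A map preserving inner products is linear; for the white noise this yields an isometric
embedding of `L²(ℝ)` into `L²(Ω)`. -/
noncomputable def linearIsometry (hW : IsWhiteNoise P W) :
    Lp ℝ 2 (volume : Measure ℝ) →ₗᵢ[ℝ] Lp ℝ 2 P :=
  LinearMap.isometryOfInner
    { toFun := hW.toLp
      map_add' := fun f g => by
        rw [← sub_eq_zero, ← inner_self_eq_zero (𝕜 := ℝ)]
        simp only [inner_sub_left, inner_sub_right, inner_add_left, inner_add_right, hW.inner_toLp]
        ring
      map_smul' := fun c f => by
        rw [← sub_eq_zero, ← inner_self_eq_zero (𝕜 := ℝ)]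
        simp only [inner_sub_left, inner_sub_right, inner_smul_left, inner_smul_right,
          hW.inner_toLp, RingHom.id_apply]
        simp }
    hW.inner_toLp

lemma linearIsometry_ae_eq (hW : IsWhiteNoise P W) (f : Lp ℝ 2 (volume : Measure ℝ)) :
    hW.linearIsometry f =ᵐ[P] W f := hW.coeFn_toLp f

/-- The expansion of `W f` along an orthonormal basis, where its pointwise convergence is known. -/
lemma ae_eq_tsum (hW : IsWhiteNoise P W)
    (B : HilbertBasis (ℤ × ℤ) ℝ (Lp ℝ 2 (volume : Measure ℝ))) (f : Lp ℝ 2 (volume : Measure ℝ))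
    (hs : ∀ᵐ ω ∂P, Summable fun p => W (B p) ω * inner ℝ (B p) f) :
    ∀ᵐ ω ∂P, W f ω = ∑' p, W (B p) ω * inner ℝ (B p) f := by
  have h := (B.hasSum_repr f).mapL hW.linearIsometry.toContinuousLinearMap
  have hc : ∀ᵐ ω ∂P, ∀ p, (hW.linearIsometry (B.repr f p • B p)) ω =
      W (B p) ω * inner ℝ (B p) f := by
    rw [ae_all_iff]
    intro p
    rw [map_smul]
    filter_upwards [Lp.coeFn_smul (B.repr f p) (hW.linearIsometry (B p)),
      hW.linearIsometry_ae_eq (B p)] with ω h1 h2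
    rw [h1, Pi.smul_apply, h2, B.repr_apply_apply, smul_eq_mul, mul_comm]
  have hs' : ∀ᵐ ω ∂P, Summable fun p => (hW.linearIsometry (B.repr f p • B p)) ω := by
    filter_upwards [hs, hc] with ω h1 h2
    simpa only [h2] using h1
  have h3 := ae_eq_tsum_of_hasSum_Lp h hs'
  filter_upwards [h3, hc, hW.linearIsometry_ae_eq f] with ω h4 h5 h6
  rw [← h6]
  refine h4.trans ?_
  congr 1
  funext p
  exact h5 p

end IsWhiteNoise

end WhiteNoise

/-! ### The reflected wavelet basis and the frequency domain -/

/-- A real valued Schwartz function viewed as a complex valued one. -/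
noncomputable def complexSchwartz (ψ : 𝓢(ℝ, ℝ)) : 𝓢(ℝ, ℂ) :=
  SchwartzMap.postcompCLM Complex.ofRealCLM ψ

lemma waveletHat_eq (ψ : 𝓢(ℝ, ℝ)) (ξ : ℝ) :
    waveletHat ψ ξ = ((√(2 * Real.pi) : ℝ) : ℂ)⁻¹ *
      𝓕 (complexSchwartz ψ) ((2 * Real.pi)⁻¹ * ξ) := by
  have h : ((√(2 * Real.pi) : ℝ) : ℂ) ≠ 0 := by
    rw [Complex.ofReal_ne_zero]; positivity
  have e := congrFun (rescaleFreq_unitaryFourier (complexSchwartz ψ)) ((2 * Real.pi)⁻¹ * ξ)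
  rw [SchwartzMap.fourier_coe, ← e]
  unfold rescaleFreq waveletHat
  rw [mul_inv_cancel_left₀ (by positivity), inv_mul_cancel_left₀ h]
  rfl

lemma IsLemarieMeyerWavelet.isAnnular_waveletHat {ψ : 𝓢(ℝ, ℝ)} (hψ : IsLemarieMeyerWavelet ψ) :
    IsAnnular (waveletHat ψ) := by
  refine ⟨?_, hψ.hasCompactSupport_hat, hψ.hat_eq_zero_near_zero⟩
  rw [funext (waveletHat_eq ψ)]
  exact contDiff_const.mul (((𝓕 (complexSchwartz ψ)).smooth ⊤).comp
    (contDiff_const.mul contDiff_id))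

/-- The reflected wavelet `x ↦ 2^{j/2} ψ(-2^j x - k)`, for `p = (j, k)`, as a complex valued
Schwartz function. Its unitary Fourier transform is `waveletFreq ψ j k`. -/
noncomputable def reflectedWavelet (ψ : 𝓢(ℝ, ℝ)) (p : ℤ × ℤ) : 𝓢(ℝ, ℂ) :=
  (2 : ℝ) ^ ((p.1 : ℝ) / 2) • SchwartzMap.compCLMOfContinuousLinearEquiv ℝ
    (ContinuousLinearEquiv.smulLeft (R₁ := ℝ) (M₁ := ℝ)
      (Units.mk0 (-(2 : ℝ) ^ p.1) (neg_ne_zero.2 (by positivity))))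
    (SchwartzMap.compSubConstCLM ℝ (p.2 : ℝ) (complexSchwartz ψ))

lemma reflectedWavelet_apply (ψ : 𝓢(ℝ, ℝ)) (p : ℤ × ℤ) (x : ℝ) :
    reflectedWavelet ψ p x = (waveletFun ψ p.1 p.2 (-x) : ℂ) := by
  have : reflectedWavelet ψ p x =
      (2 : ℝ) ^ ((p.1 : ℝ) / 2) • (ψ (-(2 : ℝ) ^ p.1 * x - p.2) : ℂ) := rfl
  rw [this, waveletFun, Complex.real_smul]
  push_cast
  ring_nf

lemma unitaryFourier_reflectedWavelet (ψ : 𝓢(ℝ, ℝ)) (p : ℤ × ℤ) :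
    unitaryFourier (reflectedWavelet ψ p) = waveletFreq ψ p.1 p.2 := by
  obtain ⟨j, k⟩ := p
  funext ξ
  have h2 : (2 : ℝ) ^ j ≠ 0 := by positivity
  set G : ℝ → ℂ := fun y =>
    (((2 : ℝ) ^ ((j : ℝ) / 2) : ℝ) : ℂ) * (Complex.exp (Complex.I * (((2 : ℝ) ^ (-j) * k * ξ : ℝ) : ℂ)) *
      (Complex.exp (-(Complex.I * (y * ((-((2 : ℝ) ^ (-j) * ξ) : ℝ) : ℂ)))) * (ψ y : ℂ))) with hG
  have e1 : ∀ x : ℝ, Complex.exp (-(Complex.I * (x * ξ))) * reflectedWavelet ψ (j, k) x =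
      G (-(2 : ℝ) ^ j * x - k) := by
    intro x
    rw [reflectedWavelet_apply, hG, waveletFun]
    simp only
    rw [show (2 : ℝ) ^ j * -x - k = -(2 : ℝ) ^ j * x - k by ring, Complex.ofReal_mul,
      ← mul_assoc (Complex.exp _) (Complex.exp _), ← Complex.exp_add]
    have : Complex.I * (((2 : ℝ) ^ (-j) * k * ξ : ℝ) : ℂ) +
        -(Complex.I * (((-(2 : ℝ) ^ j * x - k : ℝ) : ℂ) * ((-((2 : ℝ) ^ (-j) * ξ) : ℝ) : ℂ))) =
        -(Complex.I * (x * ξ)) := by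
      have h2c : (2 : ℂ) ^ j ≠ 0 := zpow_ne_zero _ two_ne_zero
      rw [zpow_neg]
      push_cast
      field_simp
      ring
    rw [this]
    ring
  unfold unitaryFourier waveletFreq
  simp_rw [e1]
  rw [Measure.integral_comp_mul_left (fun y => G (y - k)), integral_sub_right_eq_self G, hG,
    integral_const_mul, integral_const_mul]
  unfold waveletHat unitaryFourier
  rw [inv_neg, abs_neg, abs_of_pos (by positivity), Complex.real_smul]
  have e2 : (((2 : ℝ) ^ (-(j : ℝ) / 2) : ℝ) : ℂ) =
      ((((2 : ℝ) ^ j)⁻¹ : ℝ) : ℂ) * (((2 : ℝ) ^ ((j : ℝ) / 2) : ℝ) : ℂ) := by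
    rw [← Complex.ofReal_mul, ← Real.rpow_intCast, ← Real.rpow_neg (by norm_num),
      ← Real.rpow_add two_pos]
    ring_nf
  rw [e2]
  ring

lemma rescaleFreq_waveletFreq (ψ : 𝓢(ℝ, ℝ)) (p : ℤ × ℤ) :
    rescaleFreq (waveletFreq ψ p.1 p.2) = 𝓕 (reflectedWavelet ψ p) := by
  rw [← unitaryFourier_reflectedWavelet, rescaleFreq_unitaryFourier, SchwartzMap.fourier_coe]

/-- The reflection `f ↦ f(-·)` of `L²(ℝ)`. -/
noncomputable def reflectLp : Lp ℝ 2 (volume : Measure ℝ) →ₗᵢ[ℝ] Lp ℝ 2 (volume : Measure ℝ) :=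
  Lp.compMeasurePreservingₗᵢ ℝ (Neg.neg : ℝ → ℝ) (Measure.measurePreserving_neg volume)

lemma reflectLp_reflectLp (f : Lp ℝ 2 (volume : Measure ℝ)) : reflectLp (reflectLp f) = f := by
  have h1 : reflectLp (reflectLp f) =ᵐ[volume] (reflectLp f : ℝ → ℝ) ∘ Neg.neg :=
    Lp.coeFn_compMeasurePreserving _ (Measure.measurePreserving_neg volume)
  have h2 : reflectLp f =ᵐ[volume] f ∘ Neg.neg :=
    Lp.coeFn_compMeasurePreserving _ (Measure.measurePreserving_neg volume)
  have h3 := (Measure.measurePreserving_neg (volume : Measure ℝ)).quasiMeasurePreserving.ae_eq_comp h2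
  refine Lp.ext (h1.trans (h3.trans ?_))
  filter_upwards with x
  simp

/-- The orthonormal basis of reflected wavelets. -/
noncomputable def IsLemarieMeyerWavelet.reflectedBasis {ψ : 𝓢(ℝ, ℝ)}
    (hψ : IsLemarieMeyerWavelet ψ) : HilbertBasis (ℤ × ℤ) ℝ (Lp ℝ 2 (volume : Measure ℝ)) :=
  HilbertBasis.mkOfOrthogonalEqBot (hψ.orthonormal.comp_linearIsometry reflectLp) (by
    rw [Submodule.eq_bot_iff]
    intro f hf
    have h1 : reflectLp f ∈ (Submodule.span ℝ (Set.range (waveletLp ψ)))ᗮ := by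
      rw [Submodule.mem_orthogonal]
      intro u hu
      refine Submodule.span_induction (p := fun u _ => inner ℝ u (reflectLp f) = 0) ?_ ?_ ?_ ?_ hu
      · rintro _ ⟨p, rfl⟩
        rw [← reflectLp.inner_map_map, reflectLp_reflectLp]
        exact (Submodule.mem_orthogonal _ _).1 hf _ (Submodule.subset_span ⟨p, rfl⟩)
      · simp
      · intro x y _ _ hx hy
        rw [inner_add_left, hx, hy, add_zero]
      · intro c x _ hx
        rw [inner_smul_left, hx, mul_zero]
    rw [(Submodule.topologicalClosure_eq_top_iff (K := Submodule.span ℝ _)).1 hψ.dense_span, Submodule.mem_bot]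
      at h1
    rw [← reflectLp_reflectLp f, h1, map_zero])

lemma IsLemarieMeyerWavelet.reflectedBasis_apply {ψ : 𝓢(ℝ, ℝ)} (hψ : IsLemarieMeyerWavelet ψ)
    (p : ℤ × ℤ) : hψ.reflectedBasis p = reflectLp (waveletLp ψ p) := by
  unfold reflectedBasis
  rw [HilbertBasis.coe_mkOfOrthogonalEqBot]
  rfl

lemma IsLemarieMeyerWavelet.coeFn_reflectedBasis {ψ : 𝓢(ℝ, ℝ)} (hψ : IsLemarieMeyerWavelet ψ)
    (p : ℤ × ℤ) : hψ.reflectedBasis p =ᵐ[volume] fun x => waveletFun ψ p.1 p.2 (-x) := by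
  rw [hψ.reflectedBasis_apply]
  have h1 : reflectLp (waveletLp ψ p) =ᵐ[volume] waveletLp ψ p ∘ Neg.neg :=
    Lp.coeFn_compMeasurePreserving _ (Measure.measurePreserving_neg volume)
  exact h1.trans ((Measure.measurePreserving_neg
    (volume : Measure ℝ)).quasiMeasurePreserving.ae_eq_comp (memLp_waveletFun ψ p.1 p.2).coeFn_toLp)

lemma IsLemarieMeyerWavelet.re_reflectedWavelet_toLp {ψ : 𝓢(ℝ, ℝ)} (hψ : IsLemarieMeyerWavelet ψ)
    (p : ℤ × ℤ) :
    Complex.reCLM.compLp ((reflectedWavelet ψ p).toLp 2 volume) = hψ.reflectedBasis p := by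
  refine Lp.ext ?_
  filter_upwards [Complex.reCLM.coeFn_compLp ((reflectedWavelet ψ p).toLp 2 volume),
    (reflectedWavelet ψ p).coeFn_toLp 2 volume, hψ.coeFn_reflectedBasis p] with x h1 h2 h3
  rw [h1, h2, h3, reflectedWavelet_apply]
  simp

lemma IsLemarieMeyerWavelet.inner_reflectedBasis_re {ψ : 𝓢(ℝ, ℝ)} (hψ : IsLemarieMeyerWavelet ψ)
    (p : ℤ × ℤ) (f : Lp ℂ 2 (volume : Measure ℝ)) :
    inner ℝ (hψ.reflectedBasis p) (Complex.reCLM.compLp f) =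
      (inner ℂ ((reflectedWavelet ψ p).toLp 2 volume) f).re := by
  rw [L2.inner_def, L2.inner_def]
  have hint := L2.integrable_inner (𝕜 := ℂ) ((reflectedWavelet ψ p).toLp 2 volume) f
  have : (∫ x, inner ℂ (((reflectedWavelet ψ p).toLp 2 volume) x) (f x)).re =
      ∫ x, (inner ℂ (((reflectedWavelet ψ p).toLp 2 volume) x) (f x)).re :=
    (Complex.reCLM.integral_comp_comm hint).symm
  rw [this]
  refine integral_congr_ae ?_
  filter_upwards [Complex.reCLM.coeFn_compLp f,
    (reflectedWavelet ψ p).coeFn_toLp 2 volume, hψ.coeFn_reflectedBasis p] with x h1 h2 h3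
  rw [h1, h2, h3, reflectedWavelet_apply]
  simp [mul_comm]

/-- The coefficients `ε` are the values of the white noise on the reflected wavelets. -/
lemma IsWaveletCoefficients.ae_eq {Ω : Type*} [MeasurableSpace Ω] {P : Measure Ω}
    {W : Lp ℝ 2 (volume : Measure ℝ) → Ω → ℝ} {ψ : 𝓢(ℝ, ℝ)} {ε : ℤ → ℤ → Ω → ℝ}
    (hε : IsWaveletCoefficients P W ψ ε) (hψ : IsLemarieMeyerWavelet ψ) (p : ℤ × ℤ) :
    ∀ᵐ ω ∂P, ε p.1 p.2 ω = W (hψ.reflectedBasis p) ω := by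
  filter_upwards [hε p.1 p.2] with ω hω
  have hm : MemLp (rescaleFreq (waveletFreq ψ p.1 p.2)) 2 (volume : Measure ℝ) := by
    rw [rescaleFreq_waveletFreq]
    exact (𝓕 (reflectedWavelet ψ p)).memLp 2 volume
  have he : 𝓕⁻ (hm.toLp : Lp ℂ 2 (volume : Measure ℝ)) = (reflectedWavelet ψ p).toLp 2 volume := by
    have : (hm.toLp : Lp ℂ 2 (volume : Measure ℝ)) = 𝓕 ((reflectedWavelet ψ p).toLp 2 volume) := by
      rw [SchwartzMap.toLp_fourier_eq]
      refine Lp.ext ?_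
      filter_upwards [hm.coeFn_toLp, (𝓕 (reflectedWavelet ψ p)).coeFn_toLp 2 volume] with x h1 h2
      rw [h1, h2, rescaleFreq_waveletFreq]
    rw [this, FourierTransform.fourierInv_fourier_eq]
  unfold fourierWienerIntegral at hω
  rw [dif_pos hm, he] at hω
  have := congrArg Complex.re hω
  simp only [complexWienerIntegral, hψ.re_reflectedWavelet_toLp] at this
  simpa using this

/-! ### The harmonizable kernel -/

lemma integrable_min_mul_abs_rpow (c : ℝ) {θ : ℝ} (h0 : 0 < θ) (h1 : θ < 1) :
    Integrable fun ξ : ℝ => if |ξ| ≤ 1 then c * |ξ| ^ (1 - 2 * θ) else 4 * |ξ| ^ (-1 - 2 * θ) := by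
  have := (integrable_fun_norm_addHaar (volume : Measure ℝ)
    (f := fun y : ℝ => if y ≤ 1 then c * y ^ (1 - 2 * θ) else 4 * y ^ (-1 - 2 * θ))).2 ?_
  · simpa using this
  simp only [Module.finrank_self, le_refl, tsub_eq_zero_of_le, pow_zero, one_smul]
  rw [← Set.Ioc_union_Ioi_eq_Ioi (zero_le_one' ℝ)]
  refine IntegrableOn.union ?_ ?_
  · have h := (intervalIntegral.intervalIntegrable_rpow' (a := 0) (b := 1) (r := 1 - 2 * θ)
      (by linarith)).1.const_mul c
    refine IntegrableOn.congr_fun h (fun y hy => ?_) measurableSet_Ioc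
    simp [hy.2]
  · have h := (integrableOn_Ioi_rpow_of_lt (a := -1 - 2 * θ) (by linarith) one_pos).const_mul 4
    refine IntegrableOn.congr_fun h (fun y hy => ?_) measurableSet_Ioi
    have : ¬ y ≤ 1 := not_le.2 hy
    simp [this]

lemma measurable_harmonizableKernel (t θ : ℝ) : Measurable (harmonizableKernel t θ) := by
  unfold harmonizableKernel
  fun_prop

lemma memLp_harmonizableKernel (t : ℝ) {θ : ℝ} (h0 : 0 < θ) (h1 : θ < 1) :
    MemLp (harmonizableKernel t θ) 2 (volume : Measure ℝ) := by
  rw [memLp_two_iff_integrable_sq_norm (measurable_harmonizableKernel t θ).aestronglyMeasurable]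
  refine (integrable_min_mul_abs_rpow (t ^ 2) h0 h1).mono'
    ((measurable_harmonizableKernel t θ).norm.pow_const 2).aestronglyMeasurable ?_
  have h00 : ∀ᵐ ξ : ℝ, ξ ≠ 0 := by simp [ae_iff]
  filter_upwards [h00] with ξ hξ
  have hpos : 0 < |ξ| := abs_pos.2 hξ
  have e0 : Complex.I * ((t : ℂ) * (ξ : ℂ)) = Complex.I * ((t * ξ : ℝ) : ℂ) := by push_cast; ring
  have n1 : ‖Complex.exp (Complex.I * (t * ξ)) - 1‖ ^ 2 ≤ t ^ 2 * |ξ| ^ 2 := by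
    have := Real.norm_exp_I_mul_ofReal_sub_one_le (x := t * ξ)
    rw [← e0, Real.norm_eq_abs] at this
    calc _ ≤ |t * ξ| ^ 2 := by gcongr
      _ = _ := by rw [sq_abs, sq_abs]; ring
  have n2 : ‖Complex.exp (Complex.I * (t * ξ)) - 1‖ ^ 2 ≤ 4 := by
    have h := norm_sub_le (Complex.exp (Complex.I * (t * ξ))) 1
    rw [norm_cexp_I_mul, norm_one] at h
    calc _ ≤ ((1 : ℝ) + 1) ^ 2 := by gcongr
      _ = 4 := by norm_num
  have e1 : ‖harmonizableKernel t θ ξ‖ ^ 2 =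
      ‖Complex.exp (Complex.I * (t * ξ)) - 1‖ ^ 2 * |ξ| ^ (-1 - 2 * θ) := by
    unfold harmonizableKernel
    rw [norm_div, Complex.norm_real, Real.norm_of_nonneg (Real.rpow_nonneg hpos.le _), div_pow,
      ← Real.rpow_natCast (|ξ| ^ (θ + 1 / 2)), ← Real.rpow_mul hpos.le, div_eq_mul_inv,
      ← Real.rpow_neg hpos.le]
    congr 2
    push_cast
    ring
  have hr : 0 ≤ |ξ| ^ (-1 - 2 * θ) := Real.rpow_nonneg hpos.le _
  rw [Real.norm_of_nonneg (by positivity), e1]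
  split_ifs with h
  · have : |ξ| ^ (1 - 2 * θ) = |ξ| ^ 2 * |ξ| ^ (-1 - 2 * θ) := by
      rw [← Real.rpow_natCast, ← Real.rpow_add hpos]
      congr 1
      push_cast
      ring
    rw [this, ← mul_assoc (t ^ 2)]
    exact mul_le_mul_of_nonneg_right n1 hr
  · exact mul_le_mul_of_nonneg_right n2 hr

lemma memLp_rescaleFreq {g : ℝ → ℂ} (hg : MemLp g 2 (volume : Measure ℝ)) (hm : Measurable g) :
    MemLp (rescaleFreq g) 2 (volume : Measure ℝ) := by
  have hm' : Measurable (rescaleFreq g) := by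
    unfold rescaleFreq
    exact (hm.comp (measurable_const_mul _)).const_mul _
  rw [memLp_two_iff_integrable_sq_norm hm'.aestronglyMeasurable]
  have h := (memLp_two_iff_integrable_sq_norm hg.1).1 hg
  refine ((h.comp_mul_left' (R := 2 * Real.pi) (by positivity)).const_mul
    ((√(2 * Real.pi)) ^ 2)).congr ?_
  filter_upwards with x
  unfold rescaleFreq
  rw [norm_mul, mul_pow, Complex.norm_real, Real.norm_of_nonneg (Real.sqrt_nonneg _)]

lemma integral_inner_rescaleFreq (g h : ℝ → ℂ) :
    ∫ η, inner ℂ (rescaleFreq g η) (rescaleFreq h η) =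
      ∫ ξ, (starRingEnd ℂ) (g ξ) * h ξ := by
  have e : ∀ η, inner ℂ (rescaleFreq g η) (rescaleFreq h η) = ((2 * Real.pi : ℝ) : ℂ) *
      (fun ξ => (starRingEnd ℂ) (g ξ) * h ξ) (2 * Real.pi * η) := fun η => by
    have hs : ((√(2 * Real.pi) : ℝ) : ℂ) * ((√(2 * Real.pi) : ℝ) : ℂ) = ((2 * Real.pi : ℝ) : ℂ) := by
      rw [← Complex.ofReal_mul, Real.mul_self_sqrt (by positivity)]
    rw [RCLike.inner_apply]
    unfold rescaleFreq
    rw [map_mul, Complex.conj_ofReal, ← hs]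
    ring
  simp_rw [e]
  rw [integral_const_mul, Measure.integral_comp_mul_left (fun ξ => (starRingEnd ℂ) (g ξ) * h ξ),
    Complex.real_smul, ← mul_assoc, ← Complex.ofReal_mul, abs_of_pos (by positivity),
    mul_inv_cancel₀ (by positivity), Complex.ofReal_one, one_mul]

/-- The coefficients of the kernel of fractional Brownian motion along the wavelet basis, computed in
the frequency domain. -/
lemma integral_conj_waveletFreq_mul_harmonizableKernel {ψ : 𝓢(ℝ, ℝ)}
    (hψ : IsLemarieMeyerWavelet ψ) (p : ℤ × ℤ) (t θ : ℝ) :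
    ∫ ξ, (starRingEnd ℂ) (waveletFreq ψ p.1 p.2 ξ) * harmonizableKernel t θ ξ =
      waveIncr (waveletHat ψ) p t 0 θ := by
  obtain ⟨j, k⟩ := p
  have hA := hψ.isAnnular_waveletHat
  have h2 : (0 : ℝ) < (2 : ℝ) ^ j := by positivity
  set x := (2 : ℝ) ^ j * t - k with hx
  set y := (2 : ℝ) ^ j * 0 - (k : ℝ) with hy
  set c : ℂ := (((2 : ℝ) ^ (-(j : ℝ) / 2) : ℝ) : ℂ) * ((((2 : ℝ) ^ j) ^ (θ + 1 / 2) : ℝ) : ℂ)⁻¹ with hc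
  set G : ℝ → ℂ := fun η => c *
    (Complex.exp (Complex.I * (x * η)) * waveletHat ψ η / ((|η| ^ (θ + 1 / 2) : ℝ) : ℂ) -
      Complex.exp (Complex.I * (y * η)) * waveletHat ψ η / ((|η| ^ (θ + 1 / 2) : ℝ) : ℂ)) with hG
  have e1 : ∀ ξ, (starRingEnd ℂ) (waveletFreq ψ j k ξ) * harmonizableKernel t θ ξ =
      G ((2 : ℝ) ^ (-j) * ξ) := by
    intro ξ
    set η := (2 : ℝ) ^ (-j) * ξ with hη
    have hξ : ξ = (2 : ℝ) ^ j * η := by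
      rw [hη, ← mul_assoc, ← zpow_add₀ two_ne_zero]; simp
    have hk : (2 : ℝ) ^ (-j) * k * ξ = k * η := by rw [hη]; ring
    unfold waveletFreq harmonizableKernel
    rw [hk, map_mul, map_mul, Complex.conj_ofReal, conj_waveletHat, neg_neg, ← hη,
      ← Complex.exp_conj, hG, hc]
    simp only
    have a1 : |ξ| ^ (θ + 1 / 2) = ((2 : ℝ) ^ j) ^ (θ + 1 / 2) * |η| ^ (θ + 1 / 2) := by
      rw [hξ, abs_mul, abs_of_pos h2, Real.mul_rpow h2.le (abs_nonneg _)]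
    have a2 : Complex.exp ((starRingEnd ℂ) (Complex.I * ((k * η : ℝ) : ℂ))) *
        (Complex.exp (Complex.I * (t * ξ)) - 1) =
        Complex.exp (Complex.I * (x * η)) - Complex.exp (Complex.I * (y * η)) := by
      rw [mul_sub, ← Complex.exp_add, mul_one, map_mul, Complex.conj_I, Complex.conj_ofReal]
      congr 2
      · rw [hx, hξ]; push_cast; ring
      · rw [hy]; push_cast; ring
    rw [a1, Complex.ofReal_mul (((2 : ℝ) ^ j) ^ (θ + 1 / 2))]
    generalize (((2 : ℝ) ^ (-(j : ℝ) / 2) : ℝ) : ℂ) = A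
    generalize ((((2 : ℝ) ^ j) ^ (θ + 1 / 2) : ℝ) : ℂ) = D
    generalize ((|η| ^ (θ + 1 / 2) : ℝ) : ℂ) = B
    simp only [div_eq_mul_inv, mul_inv]
    linear_combination A * waveletHat ψ η * D⁻¹ * B⁻¹ * a2
  simp_rw [e1]
  rw [Measure.integral_comp_mul_left G, hG, integral_const_mul,
    integral_sub (hA.integrand x θ).integrable (hA.integrand y θ).integrable, Complex.real_smul]
  unfold waveIncr annularIncr annularInt
  rw [← mul_assoc]
  congr 1
  rw [hc, ← Complex.ofReal_inv, ← Complex.ofReal_mul, ← Complex.ofReal_mul]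
  congr 1
  rw [zpow_neg, inv_inv, abs_of_pos h2, ← Real.rpow_intCast, ← Real.rpow_mul (by norm_num),
    ← Real.rpow_neg (by norm_num), ← Real.rpow_add two_pos, ← Real.rpow_add two_pos]
  congr 1
  ring

/-- At a fixed time, multifractional Brownian motion is the value of the white noise on a function
whose coefficients along the reflected wavelets are those of the wavelet series. -/
lemma IsMultifractionalBM.exists_ae_eq {Ω : Type*} [MeasurableSpace Ω] {P : Measure Ω}
    {W : Lp ℝ 2 (volume : Measure ℝ) → Ω → ℝ} {H : ℝ → ℝ} {X : ℝ → Ω → ℝ}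
    (hX : IsMultifractionalBM P W H X) {ψ : 𝓢(ℝ, ℝ)} (hψ : IsLemarieMeyerWavelet ψ) (t : ℝ)
    (h0 : 0 < H t) (h1 : H t < 1) :
    ∃ f : Lp ℝ 2 (volume : Measure ℝ), (∀ᵐ ω ∂P, X t ω = W f ω) ∧
      ∀ p, inner ℝ (hψ.reflectedBasis p) f = (waveIncr (waveletHat ψ) p t 0 (H t)).re := by
  have hm : MemLp (rescaleFreq (harmonizableKernel t (H t))) 2 (volume : Measure ℝ) :=
    memLp_rescaleFreq (memLp_harmonizableKernel t h0 h1) (measurable_harmonizableKernel _ _)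
  refine ⟨Complex.reCLM.compLp (𝓕⁻ (hm.toLp : Lp ℂ 2 (volume : Measure ℝ))), ?_, fun p => ?_⟩
  · filter_upwards [hX.ae_eq t] with ω hω
    unfold fourierWienerIntegral at hω
    rw [dif_pos hm] at hω
    have := congrArg Complex.re hω
    simpa [complexWienerIntegral] using this
  · rw [hψ.inner_reflectedBasis_re, ← Lp.inner_fourier_eq, FourierTransform.fourier_fourierInv_eq,
      SchwartzMap.toLp_fourier_eq, L2.inner_def,
      ← integral_conj_waveletFreq_mul_harmonizableKernel hψ, ← integral_inner_rescaleFreq]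
    congr 1
    refine integral_congr_ae ?_
    filter_upwards [hm.coeFn_toLp, (𝓕 (reflectedWavelet ψ p)).coeFn_toLp 2 volume] with x e1 e2
    rw [e1, e2, rescaleFreq_waveletFreq]

/-! ### Pathwise regularity of the wavelet series -/

lemma summable_and_abs_tsum_le {κ K B t₁ t₀ : ℝ}
    (hK : ∀ t : ℝ, Summable (waveMajorant κ t) ∧ ∑' p, waveMajorant κ t p ≤ K) (hB : 0 ≤ B)
    {v : ℤ × ℤ → ℝ} (hv : ∀ p, |v p| ≤ B * (waveMajorant κ t₁ p + waveMajorant κ t₀ p)) :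
    Summable v ∧ |∑' p, v p| ≤ B * (2 * K) := by
  have hs := ((hK t₁).1.add (hK t₀).1).mul_left B
  refine ⟨Summable.of_norm_bounded hs hv, ?_⟩
  rw [← Real.norm_eq_abs]
  refine (tsum_of_norm_bounded (f := v) hs.hasSum hv).trans ?_
  rw [tsum_mul_left, (hK t₁).1.tsum_add (hK t₀).1]
  gcongr
  linarith [(hK t₁).2, (hK t₀).2]

/-- Deterministic form of the regularity of the wavelet series, for any coefficients of the allowed
growth. The difference of the series with exponents frozen at dyadic points and the series with the
exponent `H t` is as regular as `H`. -/
lemma IsAnnular.exists_series_bounds {f : ℝ → ℂ} (hf : IsAnnular f) {a b ρ N c d : ℝ}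
    (ha : 0 < a) (hb : b < 1) (hρ0 : 0 < ρ) (hρa : ρ ≤ a) (hρb : ρ ≤ 1 - b) (hN : 1 ≤ N)
    {H : ℝ → ℝ} (hH : ∀ t, H t ∈ Set.Icc a b) (hc : 1 ≤ c) (hd0 : 0 < d) (hd1 : d ≤ 1)
    (hHd : ∀ x t : ℝ, |t| ≤ N → |H x - H t| ≤ c * |x - t| ^ d) :
    ∃ C : ℝ, 0 ≤ C ∧ ∀ (M : ℝ) (e : ℤ × ℤ → ℝ), 0 ≤ M →
      (∀ p, |e p| ≤ M * coeffWeight (ρ / 4) p) →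
      (∀ θ : ℤ × ℤ → ℝ, (∀ p, θ p ∈ Set.Icc a b) → ∀ t, |t| ≤ N →
        Summable fun p => e p * (waveIncr f p t 0 (θ p)).re) ∧
      (∀ t, |t| < N → ContinuousAt (fun t => ∑' p, e p * (waveIncr f p t 0 (H t)).re) t) ∧
      (∀ t₁ t₀, |t₁| ≤ N → |t₀| ≤ N →
        |((∑' p, e p * (waveIncr f p t₁ 0 (H ((p.2 : ℝ) / (2 : ℝ) ^ p.1))).re) -
            ∑' p, e p * (waveIncr f p t₁ 0 (H t₁)).re) -
          ((∑' p, e p * (waveIncr f p t₀ 0 (H ((p.2 : ℝ) / (2 : ℝ) ^ p.1))).re) -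
            ∑' p, e p * (waveIncr f p t₀ 0 (H t₀)).re)| ≤ C * M * |t₁ - t₀| ^ d) := by
  have hab : a ≤ b := (hH 0).1.trans (hH 0).2
  obtain ⟨C, hC, HB⟩ := hf.exists_waveIncr_bounds ha hb hρ0 hρa hρb hab hN
  obtain ⟨K, hK0, hK⟩ := exists_tsum_waveMajorant_le (κ := ρ / 2) (by linarith)
  have h0N : |(0 : ℝ)| ≤ N := by rw [abs_zero]; linarith
  refine ⟨4 * C * c * K, by positivity, fun M e hM he => ?_⟩
  have hsum : ∀ θ : ℤ × ℤ → ℝ, (∀ p, θ p ∈ Set.Icc a b) → ∀ t, |t| ≤ N →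
      Summable fun p => e p * (waveIncr f p t 0 (θ p)).re := fun θ hθ t ht =>
    (summable_and_abs_tsum_le hK (mul_nonneg hM (mul_nonneg hC (Real.rpow_nonneg (abs_nonneg _) _)))
      fun p => (HB M (e p) p t 0 hM (he p) ht h0N).1 (θ p) (hθ p)).1
  -- a change of the exponent at a fixed time
  have hexp : ∀ t₁ t₀, |t₁| ≤ N → |t₀| ≤ N →
      |(∑' p, e p * (waveIncr f p t₁ 0 (H t₁)).re) - ∑' p, e p * (waveIncr f p t₁ 0 (H t₀)).re| ≤
        M * (C * (c * |t₁ - t₀| ^ d)) * (2 * K) := by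
    intro t₁ t₀ h₁ h₀
    rw [← (hsum (fun _ => H t₁) (fun _ => hH _) t₁ h₁).tsum_sub
      (hsum (fun _ => H t₀) (fun _ => hH _) t₁ h₁)]
    refine (summable_and_abs_tsum_le (t₁ := t₁) (t₀ := 0) hK (by
      have := Real.rpow_nonneg (abs_nonneg (t₁ - t₀)) d
      positivity) fun p => ?_).2
    rw [← mul_sub]
    refine ((HB M (e p) p t₁ 0 hM (he p) h₁ h0N).2.1 _ (hH t₁) _ (hH t₀)).trans ?_
    have := waveMajorant_nonneg (ρ / 2) t₁ p
    have := waveMajorant_nonneg (ρ / 2) 0 p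
    gcongr
    exact hHd t₁ t₀ h₀
  refine ⟨hsum, fun t₀ ht₀ => ?_, fun t₁ t₀ h₁ h₀ => ?_⟩
  · have hbound : ∀ t, |t| ≤ N →
        ‖(∑' p, e p * (waveIncr f p t 0 (H t)).re) - ∑' p, e p * (waveIncr f p t₀ 0 (H t₀)).re‖ ≤
          M * (C * (c * |t - t₀| ^ d)) * (2 * K) + M * (C * |t - t₀| ^ (ρ / 4)) * (2 * K) := by
      intro t ht
      have h1 := hexp t t₀ ht ht₀.le
      have h2 : |(∑' p, e p * (waveIncr f p t 0 (H t₀)).re) -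
          ∑' p, e p * (waveIncr f p t₀ 0 (H t₀)).re| ≤ M * (C * |t - t₀| ^ (ρ / 4)) * (2 * K) := by
        rw [← (hsum (fun _ => H t₀) (fun _ => hH _) t ht).tsum_sub
          (hsum (fun _ => H t₀) (fun _ => hH _) t₀ ht₀.le)]
        refine (summable_and_abs_tsum_le (t₁ := t) (t₀ := t₀) hK (by
          have := Real.rpow_nonneg (abs_nonneg (t - t₀)) (ρ / 4)
          positivity) fun p => ?_).2
        rw [← mul_sub, ← Complex.sub_re, ← waveIncr_eq_sub]
        exact (HB M (e p) p t t₀ hM (he p) ht ht₀.le).1 _ (hH t₀)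
      rw [Real.norm_eq_abs]
      exact (abs_sub_le _ (∑' p, e p * (waveIncr f p t 0 (H t₀)).re) _).trans (add_le_add h1 h2)
    have hcont : Continuous fun t : ℝ =>
        M * (C * (c * |t - t₀| ^ d)) * (2 * K) + M * (C * |t - t₀| ^ (ρ / 4)) * (2 * K) := by
      have h1 : Continuous fun t : ℝ => |t - t₀| ^ d :=
        (continuous_id.sub continuous_const).abs.rpow_const fun _ => Or.inr hd0.le
      have h2 : Continuous fun t : ℝ => |t - t₀| ^ (ρ / 4) :=
        (continuous_id.sub continuous_const).abs.rpow_const fun _ => Or.inr (by linarith)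
      fun_prop
    have hlim := hcont.tendsto t₀
    simp only [sub_self, abs_zero, Real.zero_rpow hd0.ne', mul_zero, zero_mul,
      Real.zero_rpow (show ρ / 4 ≠ 0 by positivity), add_zero] at hlim
    refine tendsto_iff_norm_sub_tendsto_zero.2 (squeeze_zero' (Filter.Eventually.of_forall fun t =>
      norm_nonneg _) ?_ hlim)
    filter_upwards [(isOpen_lt continuous_abs continuous_const).mem_nhds ht₀] with t ht
    exact hbound t ht.le
  · have h1 := hexp t₁ t₀ h₁ h₀
    have hθ : ∀ p : ℤ × ℤ, H ((p.2 : ℝ) / (2 : ℝ) ^ p.1) ∈ Set.Icc a b := fun p => hH _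
    have s1 := hsum _ hθ t₁ h₁
    have s2 := hsum _ hθ t₀ h₀
    have s3 := hsum (fun _ => H t₀) (fun _ => hH _) t₁ h₁
    have s4 := hsum (fun _ => H t₀) (fun _ => hH _) t₀ h₀
    have h2 : |((∑' p, e p * (waveIncr f p t₁ 0 (H ((p.2 : ℝ) / (2 : ℝ) ^ p.1))).re) -
          ∑' p, e p * (waveIncr f p t₀ 0 (H ((p.2 : ℝ) / (2 : ℝ) ^ p.1))).re) -
        ((∑' p, e p * (waveIncr f p t₁ 0 (H t₀)).re) -
          ∑' p, e p * (waveIncr f p t₀ 0 (H t₀)).re)| ≤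
        M * (C * (c * |t₁ - t₀| ^ d)) * (2 * K) := by
      rw [← s1.tsum_sub s2, ← s3.tsum_sub s4, ← (s1.sub s2).tsum_sub (s3.sub s4)]
      refine (summable_and_abs_tsum_le (t₁ := t₁) (t₀ := t₀) hK (by
        have := Real.rpow_nonneg (abs_nonneg (t₁ - t₀)) d
        positivity) fun p => ?_).2
      rw [← mul_sub, ← mul_sub, ← mul_sub, ← Complex.sub_re, ← Complex.sub_re, ← waveIncr_eq_sub,
        ← waveIncr_eq_sub]
      exact (HB M (e p) p t₁ t₀ hM (he p) h₁ h₀).2.2 _ (hθ p) _ (hH t₀) c d hc ⟨hd0.le, hd1⟩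
        (hHd _ t₀ h₀)
    rw [abs_le] at h1 h2 ⊢
    constructor <;> linarith [h1.1, h1.2, h2.1, h2.2]

/-- A bounded function that is locally Hölder satisfies a Hölder condition between the points of a
bounded interval and arbitrary points; the dyadic points `k / 2^j` are such arbitrary
points. -/
lemma exists_holder_of_locally_holder {a b β N : ℝ} (ha : 0 < a) (hb : b < 1) (hβ : 0 < β)
    {H : ℝ → ℝ} (hH : ∀ t, H t ∈ Set.Icc a b)
    (hHolder : ∀ K : Set ℝ, IsCompact K →
      ∃ c : ℝ, 0 < c ∧ ∀ t₁ ∈ K, ∀ t₂ ∈ K, |H t₁ - H t₂| ≤ c * |t₁ - t₂| ^ β) :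
    ∃ c : ℝ, 1 ≤ c ∧ ∀ x t : ℝ, |t| ≤ N → |H x - H t| ≤ c * |x - t| ^ min β 1 := by
  obtain ⟨c, hc, h⟩ := hHolder (Set.Icc (-(N + 1)) (N + 1)) isCompact_Icc
  have hd : 0 < min β 1 := lt_min hβ one_pos
  refine ⟨max c 1, le_max_right _ _, fun x t ht => ?_⟩
  rcases le_total |x - t| 1 with hx | hx
  · rcases (abs_nonneg (x - t)).eq_or_lt with h0 | h0
    · have : x = t := by
        rw [eq_comm, abs_eq_zero, sub_eq_zero] at h0
        exact h0
      subst this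
      simp [Real.zero_rpow hd.ne']
    · have htK := abs_le.1 ht
      have hxt := abs_le.1 hx
      calc |H x - H t| ≤ c * |x - t| ^ β :=
            h x ⟨by linarith, by linarith⟩ t ⟨by linarith, by linarith⟩
        _ ≤ max c 1 * |x - t| ^ min β 1 := by
          gcongr ?_ * ?_
          · exact le_max_left _ _
          · exact Real.rpow_le_rpow_of_exponent_ge h0 hx (min_le_left _ _)
  · have h1 : |H x - H t| ≤ 1 := by
      rw [abs_le]
      constructor <;> linarith [(hH x).1, (hH x).2, (hH t).1, (hH t).2]
    have h2 : 1 ≤ |x - t| ^ min β 1 := Real.one_le_rpow hx hd.le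
    have h3 : 1 ≤ max c 1 := le_max_right _ _
    nlinarith

lemma waveletProcessTerm_eq {Ω : Type*} (ψ : 𝓢(ℝ, ℝ)) (H : ℝ → ℝ) (ε : ℤ → ℤ → Ω → ℝ) (t : ℝ)
    (ω : Ω) (p : ℤ × ℤ) :
    waveletProcessTerm ψ H ε t ω p =
      ε p.1 p.2 ω * (waveIncr (waveletHat ψ) p t 0 (H ((p.2 : ℝ) / (2 : ℝ) ^ p.1))).re := by
  have h : ∀ x θ, annularInt (waveletHat ψ) x θ = bigPsi ψ x θ := fun _ _ => rfl
  unfold waveletProcessTerm waveIncr annularIncr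
  rw [h, h, Complex.re_ofReal_mul, Complex.sub_re, mul_zero, zero_sub]
  ring

theorem theorem1 {Ω : Type*} [MeasurableSpace Ω] (P : Measure Ω) [IsProbabilityMeasure P]
    (a b β : ℝ) (ha : 0 < a) (hb : b < 1) (hβ : b < β)
    (H : ℝ → ℝ) (hH : ∀ t, H t ∈ Set.Icc a b)
    (hHolder : ∀ K : Set ℝ, IsCompact K →
      ∃ c : ℝ, 0 < c ∧ ∀ t₁ ∈ K, ∀ t₂ ∈ K, |H t₁ - H t₂| ≤ c * |t₁ - t₂| ^ β)
    (hab : 1 - b > (1 - a) * (1 - a * b⁻¹))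
    (ψ : 𝓢(ℝ, ℝ)) (hψ : IsLemarieMeyerWavelet ψ)
    (W : Lp ℝ 2 (volume : Measure ℝ) → Ω → ℝ) (hW : IsWhiteNoise P W)
    (ε : ℤ → ℤ → Ω → ℝ) (hε : IsWaveletCoefficients P W ψ ε)
    (X : ℝ → Ω → ℝ) (hX : IsMultifractionalBM P W H X)
    (u v : ℝ) :
    (∀ᵐ ω ∂P, ∀ t : ℝ, Summable (waveletProcessTerm ψ H ε t ω)) ∧
    ∃ d : ℝ, b < d ∧ d ≤ 1 ∧
      ∃ C₁ : Ω → ℝ, Measurable C₁ ∧ (∀ ω, 0 ≤ C₁ ω) ∧ (∀ p : ℝ≥0, MemLp C₁ p P) ∧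
        ∀ᵐ ω ∂P, ∀ t₀ ∈ Set.Icc u v, ∀ t₁ ∈ Set.Icc u v,
          |(waveletProcess ψ H ε t₁ ω - X t₁ ω) - (waveletProcess ψ H ε t₀ ω - X t₀ ω)|
            ≤ C₁ ω * |t₁ - t₀| ^ d := by
  have hβ0 : 0 < β := by linarith [(hH 0).1, (hH 0).2]
  set d := min β 1 with hd
  have hd0 : 0 < d := lt_min hβ0 one_pos
  have hd1 : d ≤ 1 := min_le_right _ _
  set ρ := min a (1 - b) with hρ
  have hρ0 : 0 < ρ := lt_min ha (by linarith)
  have hρa : ρ ≤ a := min_le_left _ _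
  have hρb : ρ ≤ 1 - b := min_le_right _ _
  have hf := hψ.isAnnular_waveletHat
  set B := hψ.reflectedBasis with hB
  have hhol := fun N : ℝ => exists_holder_of_locally_holder (N := N) ha hb hβ0 hH hHolder
  choose c hc hHd using hhol
  have hbounds := fun (N : ℝ) (hN : 1 ≤ N) =>
    hf.exists_series_bounds ha hb hρ0 hρa hρb hN hH (hc N) hd0 hd1 (hHd N)
  obtain ⟨M, hMm, hM0, hMLp, hM⟩ := exists_coeff_bound (P := P) (V := fun p => W (B p))
    (fun p => hW.isGaussianProcess.aemeasurable _)
    (fun p => hW.map_eq_gaussianReal (B.orthonormal.1 p)) (δ := ρ / 4) (by linarith)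
  have hεB : ∀ᵐ ω ∂P, ∀ p : ℤ × ℤ, ε p.1 p.2 ω = W (B p) ω :=
    ae_all_iff.2 fun p => hε.ae_eq hψ p
  have hsum : ∀ᵐ ω ∂P, ∀ t : ℝ, ∀ θ : ℤ × ℤ → ℝ, (∀ p, θ p ∈ Set.Icc a b) →
      Summable fun p => W (B p) ω * (waveIncr (waveletHat ψ) p t 0 (θ p)).re := by
    filter_upwards [hM] with ω hω t θ hθ
    obtain ⟨C, -, hC⟩ := hbounds (|t| + 1) (by linarith [abs_nonneg t])
    exact (hC (M ω) (fun p => W (B p) ω) (hM0 ω) hω).1 θ hθ t (by linarith)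
  have hXr : ∀ᵐ ω ∂P, ∀ r : ℚ, X r ω =
      ∑' p, W (B p) ω * (waveIncr (waveletHat ψ) p r 0 (H r)).re := by
    rw [ae_all_iff]
    intro r
    obtain ⟨f, h1, h2⟩ := hX.exists_ae_eq hψ r (ha.trans_le (hH r).1) ((hH r).2.trans_lt hb)
    have h3 := hW.ae_eq_tsum B f (by
      filter_upwards [hsum] with ω hω
      simpa only [h2, hB] using hω r (fun _ => H r) fun _ => hH r)
    filter_upwards [h1, h3] with ω e1 e2
    rw [e1, e2]
    simp only [h2, hB]
  refine ⟨?_, d, lt_min hβ hb, hd1, ?_⟩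
  · filter_upwards [hsum, hεB] with ω hω he t
    refine (hω t (fun p => H ((p.2 : ℝ) / (2 : ℝ) ^ p.1)) fun _ => hH _).congr fun p => ?_
    rw [waveletProcessTerm_eq, he]
  set N := |u| + |v| + 1 with hN
  obtain ⟨C, hC0, hC⟩ := hbounds N (by linarith [abs_nonneg u, abs_nonneg v])
  refine ⟨fun ω => C * M ω, hMm.const_mul C, fun ω => mul_nonneg hC0 (hM0 ω),
    fun p => (hMLp p).const_mul C, ?_⟩
  filter_upwards [hM, hεB, hXr, hX.continuous_paths] with ω hω he hr hXc
  obtain ⟨-, hcont, hinc⟩ := hC (M ω) (fun p => W (B p) ω) (hM0 ω) hω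
  -- both sides are continuous and agree at rational times
  have hXS : ∀ t, |t| < N →
      X t ω = ∑' p, W (B p) ω * (waveIncr (waveletHat ψ) p t 0 (H t)).re := by
    intro t ht
    by_contra hne
    have h1 := (hXc.continuousAt (x := t)).sub (hcont t ht)
    have h2 := h1.eventually_ne (sub_ne_zero.2 hne)
    obtain ⟨_, ⟨r, rfl⟩, hx⟩ := (Rat.denseRange_cast (𝕜 := ℝ)).inter_nhds_nonempty h2
    exact hx (sub_eq_zero.2 (hr r))
  have hZ : ∀ t, waveletProcess ψ H ε t ω = ∑' p, W (B p) ω *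
      (waveIncr (waveletHat ψ) p t 0 (H ((p.2 : ℝ) / (2 : ℝ) ^ p.1))).re := by
    intro t
    unfold waveletProcess
    congr 1
    funext p
    rw [waveletProcessTerm_eq, he]
  have hlt : ∀ t ∈ Set.Icc u v, |t| < N := by
    intro t ht
    rw [abs_lt]
    constructor <;> linarith [ht.1, ht.2, neg_abs_le u, le_abs_self v, abs_nonneg u, abs_nonneg v]
  intro t₀ h₀ t₁ h₁
  rw [hXS t₀ (hlt t₀ h₀), hXS t₁ (hlt t₁ h₁), hZ, hZ]
  exact hinc t₁ t₀ (hlt t₁ h₁).le (hlt t₀ h₀).le
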